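/- Let $P=\partial_t+\sum_{i,j=1}^n\partial_i\big(a^{ij}(x,t)\,\partial_j\,\cdot\,\big)$, where $\mathbf A=(a^{ij})$ is a real symmetric matrix of functions that are Lipschitz continuous on $D=\{(x,t)\in\mathbb R^n\times[0,1] : |x|\ge 1\}$ and satisfy, for constants $\Lambda\ge\lambda>0$ and $M,E>0$, $$\lambda|\xi|^2\le\sum_{i,j}a^{ij}(x,t)\xi_i\xi_j\le\Lambda|\xi|^2\qquad\text{for all }\xi\in\mathbb R^n,\ (x,t)\in D,$$ and, for all $i,j$ and almost every $(x,t)\in D$, $$|\nabla_x a^{ij}(x,t)|+|\partial_t a^{ij}(x,t)|\le M,\qquad |\nabla_x a^{ij}(x,t)|\le\frac{E}{|x|}.$$ Let $\psi$ be a smooth cut-off function with $\psi=0$ on $[0,\tfrac14]\cup[\tfrac34,1]$ and $\psi=2$ on $[\tfrac13,\tfrac23]$, non-decreasing on $[\tfrac14,\tfrac13]$ and non-increasing on $[\tfrac23,\tfrac34]$. For $R>0$ and $\gamma>0$ put $$Q_R=\{(x,t) : 1<|x|<R,\ \tfrac18<t<\tfrac78\},\qquad \Psi(x,t)=\gamma(1-t)R^{2/3}|x|^{4/3}+\psi(t)R^2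 .$$ **Proposition 1.7.** There are an absolute constant $c>0$, a constant $E_0=E_0(n,\Lambda,\lambda)>0$ and, whenever $0<E<E_0$, a constant $\gamma_0=\gamma_0(n,\Lambda,\lambda,M,E)>0$ (which may also depend on the choice of the cut-off $\psi$, but on nothing else) such that the following holds. If $E<E_0$ and $\mathbf A$ is as above, then for every $R>0$, every $\gamma\ge\gamma_0$ and every real-valued $v\in C_0^\infty(Q_R)$ (smooth, with compact support contained in $Q_R$), $$c\lambda^2\int_{Q_R}e^{2\Psi}\big(\gamma^3R^2|v|^2+\gamma|\nabla v|^2\big)\,dx\,dt\le\int_{Q_R}e^{2\Psi}|Pv|^2\,dx\,dt ,$$ where $\nabla$ is the gradient in $x$. -/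

import Mathlib

open MeasureTheory Set
open scoped ContDiff Gradient

/-- The exterior space-time domain: `|x| ≥ 1`, `0 ≤ t ≤ 1`. -/
def exteriorDomain (n : ℕ) : Set (EuclideanSpace ℝ (Fin n) × ℝ) :=
  {p | 1 ≤ ‖p.1‖ ∧ p.2 ∈ Icc (0 : ℝ) 1}

/-- The standing assumptions on the coefficient matrix `A = (a^{ij}(x,t))` in the exterior domain.
Each entry is a Lipschitz function, so that its first derivatives exist almost everywhere, and the
derivative bounds are required almost everywhere. The Lipschitz constant `K` is only qualitative. -/
structure AdmissibleCoefficients {n : ℕ} (lam Lam M E : ℝ)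
    (A : EuclideanSpace ℝ (Fin n) → ℝ → Matrix (Fin n) (Fin n) ℝ) : Prop where
  symm : ∀ p ∈ exteriorDomain n, (A p.1 p.2).IsSymm
  elliptic : ∀ p ∈ exteriorDomain n, ∀ ξ : EuclideanSpace ℝ (Fin n),
    lam * ‖ξ‖ ^ 2 ≤ ∑ i, ∑ j, A p.1 p.2 i j * ξ i * ξ j ∧
      ∑ i, ∑ j, A p.1 p.2 i j * ξ i * ξ j ≤ Lam * ‖ξ‖ ^ 2
  lipschitz : ∀ i j, ∃ K, LipschitzOnWith K
    (fun p : EuclideanSpace ℝ (Fin n) × ℝ => A p.1 p.2 i j) (exteriorDomain n)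
  deriv_bound : ∀ i j, ∀ᵐ p ∂(volume.restrict (exteriorDomain n)),
    ‖∇ (fun y => A y p.2 i j) p.1‖ + |deriv (fun s => A p.1 s i j) p.2| ≤ M
  grad_decay : ∀ i j, ∀ᵐ p ∂(volume.restrict (exteriorDomain n)),
    ‖∇ (fun y => A y p.2 i j) p.1‖ ≤ E / ‖p.1‖

/-- The backward parabolic operator
`P v = ∂_t v + ∑_{i,j} ∂_i (a^{ij} ∂_j v)`, at the point `(x, t)`. -/
noncomputable def backwardParabolic {n : ℕ}
    (A : EuclideanSpace ℝ (Fin n) → ℝ → Matrix (Fin n) (Fin n) ℝ)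
    (v : EuclideanSpace ℝ (Fin n) × ℝ → ℝ) (p : EuclideanSpace ℝ (Fin n) × ℝ) : ℝ :=
  deriv (fun s => v (p.1, s)) p.2 +
    ∑ i, ∑ j, lineDeriv ℝ
      (fun y => A y p.2 i j *
        lineDeriv ℝ (fun z => v (z, p.2)) y (EuclideanSpace.single j 1))
      p.1 (EuclideanSpace.single i 1)

/-- The smooth cut-off functions in time: equal to `0` on `[0,1/4] ∪ [3/4,1]` and to `2` on
`[1/3,2/3]`, increasing and decreasing, respectively, on the two transition intervals. -/
structure IsTimeCutoff (ψ : ℝ → ℝ) : Prop where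
  smooth : ContDiff ℝ ∞ ψ
  eq_zero : ∀ t ∈ Icc (0 : ℝ) (1 / 4) ∪ Icc (3 / 4 : ℝ) 1, ψ t = 0
  eq_two : ∀ t ∈ Icc (1 / 3 : ℝ) (2 / 3), ψ t = 2
  mono : MonotoneOn ψ (Icc (1 / 4 : ℝ) (1 / 3))
  anti : AntitoneOn ψ (Icc (2 / 3 : ℝ) (3 / 4))

/-- The open cylinder `Q_R = {1 < |x| < R, 1/8 < t < 7/8}`. -/
def carlemanCylinder (n : ℕ) (R : ℝ) : Set (EuclideanSpace ℝ (Fin n) × ℝ) :=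
  {p | 1 < ‖p.1‖ ∧ ‖p.1‖ < R ∧ p.2 ∈ Ioo (1 / 8 : ℝ) (7 / 8)}

/-- The weight exponent `Ψ = γ (1 - t) R^{2/3} |x|^{4/3} + ψ(t) R²`. -/
noncomputable def carlemanWeight {n : ℕ} (γ R : ℝ) (ψ : ℝ → ℝ)
    (p : EuclideanSpace ℝ (Fin n) × ℝ) : ℝ :=
  γ * (1 - p.2) * R ^ (2 / 3 : ℝ) * ‖p.1‖ ^ (4 / 3 : ℝ) + ψ p.2 * R ^ 2

/-! Put `u = exp Ψ * v`. The conjugated operator is S + T, with S u = div(A∇u) + F u, F = A∇Ψ·∇Ψ -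
∂_tΨ (`conjPotential`), and T u = ∂_t u - 2 A∇Ψ·∇u - div(A∇Ψ) u (`conjugated_operator_eq`). In (S u
+ T u)² = (S u)² + (T u)² + 2 S u T u the cross term is, up to the divergence of a compactly
supported Lipschitz field, a quadratic form in u and ∇u (`carleman_identity`). Its main part is 4
D²Ψ(A∇u, A∇u) + 4 D²Ψ(A∇Ψ, A∇Ψ) u².

Let r = |x| and m = (R/r)^(2/3). Since |x|^(4/3) is convex, D²Ψ is at least a multiple of γm;
moreover |∇Ψ| is comparable to γmr, and m³r² = R². So the two main terms dominate λ²γm|∇u|² and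
λ²γ³R²u². First-order derivatives of A in x enter against ∇Ψ, as (E/r)(γmr) = Eγm, and are absorbed
for small E. What involves M or ψ'' has a lower power of γ and is absorbed for large γ.

Two obstacles remain. As A is only Lipschitz, div(A∇Ψ) cannot be differentiated. In the vector field
it is replaced by `hessTrace`, which can; the difference h, of size Eγm, leaves the term 2hu
div(A∇u) = 2hu(S u - F u). The square (S u)² takes care of the first summand. But F contains -ψ'R²,
and Eγm|ψ'|R² is not bounded by γ³R² uniformly in R, because m is not. The remedy is to add div(W u
A∇u) with a multiplier W close to -4n²Eγm sign(ψ'): it produces -Wψ'R²u², which has the good sign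
and dominates the bad term (`multiplier`, `carleman_scalar_inequality`). Only the sign of ψ' matters
here, not its size.

The pointwise inequality `CarlemanPoint.pointwise_inequality` then holds almost everywhere by
Rademacher's theorem; integrating it removes the divergence, and `CarlemanPoint.weighted_le` returns
from u to v. -/

/-! ### Algebra of bounded Lipschitz functions. -/

/-- Bounded Lipschitz functions. -/
structure BddLipschitz {X : Type*} [PseudoMetricSpace X] (f : X → ℝ) : Prop where
  lipschitz : ∃ K, LipschitzWith K f
  bdd : ∃ C, ∀ x, |f x| ≤ C

namespace BddLipschitz

section Metric

variable {X : Type*} [PseudoMetricSpace X] {f g : X → ℝ}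

theorem const (c : ℝ) : BddLipschitz (fun _ : X => c) :=
  ⟨⟨0, LipschitzWith.const c⟩, ⟨|c|, fun _ => le_rfl⟩⟩

theorem add (hf : BddLipschitz f) (hg : BddLipschitz g) : BddLipschitz (fun x => f x + g x) := by
  obtain ⟨⟨K, hK⟩, C, hC⟩ := hf
  obtain ⟨⟨K', hK'⟩, C', hC'⟩ := hg
  exact ⟨⟨K + K', hK.add hK'⟩, ⟨C + C', fun x =>
    (abs_add_le _ _).trans (add_le_add (hC x) (hC' x))⟩⟩

theorem neg (hf : BddLipschitz f) : BddLipschitz (fun x => -f x) := by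
  obtain ⟨⟨K, hK⟩, C, hC⟩ := hf
  exact ⟨⟨K, hK.neg⟩, ⟨C, fun x => by simpa using hC x⟩⟩

theorem sub (hf : BddLipschitz f) (hg : BddLipschitz g) : BddLipschitz (fun x => f x - g x) := by
  simpa [sub_eq_add_neg] using hf.add hg.neg

theorem mul (hf : BddLipschitz f) (hg : BddLipschitz g) : BddLipschitz (fun x => f x * g x) := by
  obtain ⟨⟨K, hK⟩, C, hC⟩ := hf
  obtain ⟨⟨K', hK'⟩, C', hC'⟩ := hg
  refine ⟨⟨⟨|C|, abs_nonneg _⟩ * K' + ⟨|C'|, abs_nonneg _⟩ * K,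
    LipschitzWith.of_dist_le_mul fun x y => ?_⟩, ⟨C * C', fun x => ?_⟩⟩
  · have h1 := hK.dist_le_mul x y
    have h2 := hK'.dist_le_mul x y
    rw [Real.dist_eq] at h1 h2 ⊢
    have e : f x * g x - f y * g y = f x * (g x - g y) + g y * (f x - f y) := by ring
    rw [e]
    refine (abs_add_le _ _).trans ?_
    rw [abs_mul, abs_mul]
    have h3 : |f x| ≤ |C| := (hC x).trans (le_abs_self _)
    have h4 : |g y| ≤ |C'| := (hC' y).trans (le_abs_self _)
    have h5 := mul_le_mul h3 h2 (abs_nonneg _) (abs_nonneg _)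
    have h6 := mul_le_mul h4 h1 (abs_nonneg _) (abs_nonneg _)
    push_cast
    change _ ≤ (|C| * K' + |C'| * K) * dist x y
    linarith
  · rw [abs_mul]
    exact mul_le_mul (hC x) (hC' x) (abs_nonneg _) ((abs_nonneg _).trans (hC x))

theorem const_mul (hf : BddLipschitz f) (c : ℝ) : BddLipschitz (fun x => c * f x) :=
  (const c).mul hf

theorem sum {ι : Type*} (s : Finset ι) {f : ι → X → ℝ} (hf : ∀ i, BddLipschitz (f i)) :
    BddLipschitz (fun x => ∑ i ∈ s, f i x) := by
  classical
  induction s using Finset.induction_on with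
  | empty => simpa using const 0
  | insert i s hi ih => simpa [Finset.sum_insert hi] using (hf i).add ih

end Metric

theorem of_contDiff {X : Type*} [NormedAddCommGroup X] [NormedSpace ℝ X] {f : X → ℝ}
    (hf : ContDiff ℝ 1 f) (hc : HasCompactSupport f) : BddLipschitz f := by
  obtain ⟨K, hK⟩ := hf.lipschitzWith_of_hasCompactSupport hc (by simp)
  obtain ⟨C, hC⟩ := hc.exists_bound_of_continuous hf.continuous
  exact ⟨⟨K, hK⟩, ⟨C, hC⟩⟩

end BddLipschitz

/-! ### Directional derivatives, Rademacher's theorem and integration of derivatives. -/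

/-- The derivative of `f` in direction `v`, as a function of the base point. -/
noncomputable def dirDeriv {X : Type*} [NormedAddCommGroup X] [NormedSpace ℝ X] (v : X)
    (f : X → ℝ) (p : X) : ℝ := fderiv ℝ f p v

/-- Bounded measurable functions of compact support are integrable. -/
theorem integrable_of_bdd_of_hasCompactSupport {X : Type*} [TopologicalSpace X]
    [R1Space X] [MeasurableSpace X] [BorelSpace X] {f : X → ℝ}
    (μ : Measure X) [IsFiniteMeasureOnCompacts μ] (hm : Measurable f) {C : ℝ}
    (hb : ∀ x, |f x| ≤ C) (hc : HasCompactSupport f) : Integrable f μ := by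
  rw [← integrableOn_iff_integrable_of_support_subset (subset_tsupport f)]
  exact Measure.integrableOn_of_bounded hc.measure_lt_top.ne hm.aestronglyMeasurable
    (Filter.Eventually.of_forall hb)

section DirDeriv

variable {X : Type*} [NormedAddCommGroup X] [NormedSpace ℝ X] {f g : X → ℝ} {p v w : X}

theorem HasFDerivAt.dirDeriv_eq {f' : X →L[ℝ] ℝ} (h : HasFDerivAt f f' p) :
    dirDeriv v f p = f' v := by rw [dirDeriv, h.fderiv]

theorem dirDeriv_add (hf : DifferentiableAt ℝ f p) (hg : DifferentiableAt ℝ g p) :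
    dirDeriv v (fun x => f x + g x) p = dirDeriv v f p + dirDeriv v g p := by
  exact (hf.hasFDerivAt.add hg.hasFDerivAt).dirDeriv_eq

theorem dirDeriv_sub (hf : DifferentiableAt ℝ f p) (hg : DifferentiableAt ℝ g p) :
    dirDeriv v (fun x => f x - g x) p = dirDeriv v f p - dirDeriv v g p := by
  exact (hf.hasFDerivAt.sub hg.hasFDerivAt).dirDeriv_eq

theorem dirDeriv_mul (hf : DifferentiableAt ℝ f p) (hg : DifferentiableAt ℝ g p) :
    dirDeriv v (fun x => f x * g x) p = f p * dirDeriv v g p + g p * dirDeriv v f p := by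
  exact (hf.hasFDerivAt.mul hg.hasFDerivAt).dirDeriv_eq

theorem dirDeriv_const (c : ℝ) : dirDeriv v (fun _ => c) p = 0 := by
  rw [(hasFDerivAt_const c p).dirDeriv_eq]; rfl

theorem dirDeriv_const_mul (c : ℝ) (hf : DifferentiableAt ℝ f p) :
    dirDeriv v (fun x => c * f x) p = c * dirDeriv v f p := by
  rw [(hf.hasFDerivAt.const_mul c).dirDeriv_eq]; rfl

theorem dirDeriv_sum {ι : Type*} (s : Finset ι) {f : ι → X → ℝ}
    (hf : ∀ i, DifferentiableAt ℝ (f i) p) :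
    dirDeriv v (fun x => ∑ i ∈ s, f i x) p = ∑ i ∈ s, dirDeriv v (f i) p := by
  rw [(HasFDerivAt.fun_sum fun i _ => (hf i).hasFDerivAt).dirDeriv_eq]
  simp [dirDeriv]

theorem Filter.EventuallyEq.dirDeriv_eq (h : f =ᶠ[nhds p] g) :
    dirDeriv v f p = dirDeriv v g p := by
  rw [dirDeriv, dirDeriv, h.fderiv_eq]

theorem Filter.EventuallyEq.dirDeriv (h : f =ᶠ[nhds p] g) :
    dirDeriv v f =ᶠ[nhds p] dirDeriv v g := by
  filter_upwards [h.eventuallyEq_nhds] with x hx using hx.dirDeriv_eq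

theorem ContDiff.dirDeriv (hf : ContDiff ℝ ∞ f) (v : X) : ContDiff ℝ ∞ (dirDeriv v f) := by
  have h : ContDiff ℝ ∞ (fderiv ℝ f) := hf.fderiv_right (by simp)
  exact h.clm_apply contDiff_const

theorem HasCompactSupport.dirDeriv (hf : HasCompactSupport f) (v : X) :
    HasCompactSupport (dirDeriv v f) := by
  have := hf.fderiv (𝕜 := ℝ)
  exact this.comp_left (g := fun L : X →L[ℝ] ℝ => L v) (by simp)

theorem dirDeriv_comm (hf : ContDiff ℝ ∞ f) (v w p : X) :
    dirDeriv v (dirDeriv w f) p = dirDeriv w (dirDeriv v f) p := by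
  have h : DifferentiableAt ℝ (fderiv ℝ f) p :=
    ((hf.fderiv_right (m := ∞) (by simp)).differentiable (by simp)) p
  have key : ∀ v w, dirDeriv v (dirDeriv w f) p = fderiv ℝ (fderiv ℝ f) p v w := by
    intro v w
    have : HasFDerivAt (dirDeriv w f) ((fderiv ℝ (fderiv ℝ f) p).flip w) p := by
      have := h.hasFDerivAt.clm_apply (hasFDerivAt_const w p)
      simp only [ContinuousLinearMap.comp_zero, zero_add] at this
      exact this
    rw [this.dirDeriv_eq]; rfl
  rw [key, key]
  have hs : IsSymmSndFDerivAt ℝ f p := hf.contDiffAt.isSymmSndFDerivAt (by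
    simp only [minSmoothness_of_isRCLikeNormedField]; exact WithTop.coe_le_coe.2 (le_top (a := (2 : ℕ∞))))
  exact hs.eq v w

theorem BddLipschitz.differentiableAt_ae [FiniteDimensional ℝ X] [MeasurableSpace X]
    [BorelSpace X] (μ : Measure X) [μ.IsAddHaarMeasure] (hf : BddLipschitz f) :
    ∀ᵐ x ∂μ, DifferentiableAt ℝ f x := by
  obtain ⟨K, hK⟩ := hf.lipschitz
  exact hK.ae_differentiableAt

theorem LipschitzWith.abs_dirDeriv_le {K : NNReal} (hf : LipschitzWith K f) (v p : X) :
    |dirDeriv v f p| ≤ K * ‖v‖ :=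
  ((fderiv ℝ f p).le_opNorm v).trans
    (mul_le_mul_of_nonneg_right (norm_fderiv_le_of_lipschitz ℝ hf) (norm_nonneg _))

theorem measurable_dirDeriv [MeasurableSpace X] [OpensMeasurableSpace X] (v : X) (f : X → ℝ) :
    Measurable (_root_.dirDeriv v f) := measurable_fderiv_apply_const ℝ f v

/-- Integration by parts against the constant 1. This serves as the divergence theorem for the
merely Lipschitz fields of the Carleman identity. -/
theorem integral_dirDeriv_eq_zero [FiniteDimensional ℝ X] [MeasurableSpace X] [BorelSpace X]
    (μ : Measure X) [μ.IsAddHaarMeasure] (hf : BddLipschitz f) (hc : HasCompactSupport f) (v : X) :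
    ∫ x, _root_.dirDeriv v f x ∂μ = 0 := by
  obtain ⟨K, hK⟩ := hf.lipschitz
  have h := (LipschitzWith.const (1 : ℝ) (α := X)).integral_lineDeriv_mul_eq (μ := μ) hK hc (-v)
  simp only [neg_neg, mul_one] at h
  have h0 : ∀ x, lineDeriv ℝ (fun _ : X => (1 : ℝ)) x (-v) = 0 := fun x => by
    simp [lineDeriv]
  simp only [h0, zero_mul, integral_zero] at h
  rw [h]
  refine integral_congr_ae ?_
  filter_upwards [hK.ae_differentiableAt (μ := μ)] with x hx
  exact hx.lineDeriv_eq_fderiv.symm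

theorem integrable_dirDeriv [MeasurableSpace X] [BorelSpace X]
    (μ : Measure X) [IsFiniteMeasureOnCompacts μ] (hf : BddLipschitz f)
    (hc : HasCompactSupport f) (v : X) : Integrable (_root_.dirDeriv v f) μ := by
  obtain ⟨K, hK⟩ := hf.lipschitz
  exact integrable_of_bdd_of_hasCompactSupport μ (measurable_dirDeriv v f)
    (fun x => hK.abs_dirDeriv_le v x) (hc.dirDeriv v)

end DirDeriv

/-! ### The differential Carleman identity. -/

section Divergence

variable {X : Type*} [NormedAddCommGroup X] [NormedSpace ℝ X] {n : ℕ}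

/-- The vector field `A f` obtained by applying the matrix field `a` to the vector field `f`. -/
def flux (a : Fin n → Fin n → X → ℝ) (f : Fin n → X → ℝ) (i : Fin n) (x : X) : ℝ :=
  ∑ j, a i j x * f j x

/-- The quadratic form `A f · f`. -/
def energy (a : Fin n → Fin n → X → ℝ) (f : Fin n → X → ℝ) (x : X) : ℝ :=
  ∑ i, flux a f i x * f i x

/-- The frame derivatives of a function. -/
noncomputable def frameGrad (e : Fin n → X) (f : X → ℝ) (i : Fin n) : X → ℝ := dirDeriv (e i) f

/-- The divergence of a vector field with respect to a frame. -/
noncomputable def frameDiv (e : Fin n → X) (f : Fin n → X → ℝ) (x : X) : ℝ :=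
  ∑ i, dirDeriv (e i) (f i) x

/-- The trace `∑ a_ij ∂_i ∂_j Ψ`. -/
noncomputable def hessTrace (a : Fin n → Fin n → X → ℝ) (e : Fin n → X) (Ψ : X → ℝ) (x : X) : ℝ :=
  ∑ i, ∑ j, a i j x * dirDeriv (e i) (dirDeriv (e j) Ψ) x

/-- The potential `A∇Ψ·∇Ψ - ∂_t Ψ` of the conjugated operator. -/
noncomputable def conjPotential (a : Fin n → Fin n → X → ℝ) (e : Fin n → X) (τ : X) (Ψ : X → ℝ)
    (x : X) : ℝ :=
  energy a (frameGrad e Ψ) x - dirDeriv τ Ψ x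

/-- Spatial components of the vector field of the Carleman identity. -/
noncomputable def carlemanSpaceField (a : Fin n → Fin n → X → ℝ) (e : Fin n → X) (τ : X)
    (Ψ u W : X → ℝ) (i : Fin n) (x : X) : ℝ :=
  2 * (flux a (frameGrad e u) i x * dirDeriv τ u x)
    - 4 * (flux a (frameGrad e u) i x * ∑ k, flux a (frameGrad e Ψ) k x * frameGrad e u k x)
    + 2 * (flux a (frameGrad e Ψ) i x * energy a (frameGrad e u) x)
    - 2 * (hessTrace a e Ψ x * u x * flux a (frameGrad e u) i x)
    - 2 * (conjPotential a e τ Ψ x * (u x * u x) * flux a (frameGrad e Ψ) i x)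
    + W x * u x * flux a (frameGrad e u) i x

/-- Time component of the vector field of the Carleman identity. -/
noncomputable def carlemanTimeField (a : Fin n → Fin n → X → ℝ) (e : Fin n → X) (τ : X)
    (Ψ u : X → ℝ) (x : X) : ℝ :=
  conjPotential a e τ Ψ x * (u x * u x) - energy a (frameGrad e u) x

variable {a : Fin n → Fin n → X → ℝ} {e : Fin n → X} {τ : X} {Ψ u W : X → ℝ} {p v : X}
  {f : Fin n → X → ℝ}

theorem DifferentiableAt.flux (ha : ∀ i j, DifferentiableAt ℝ (a i j) p)
    (hf : ∀ i, DifferentiableAt ℝ (f i) p) (i : Fin n) :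
    DifferentiableAt ℝ (flux a f i) p := by
  have h : ∀ j, DifferentiableAt ℝ (fun x => a i j x * f j x) p := fun j => (ha i j).mul (hf j)
  exact DifferentiableAt.fun_sum fun j _ => h j

theorem DifferentiableAt.energy (ha : ∀ i j, DifferentiableAt ℝ (a i j) p)
    (hf : ∀ i, DifferentiableAt ℝ (f i) p) : DifferentiableAt ℝ (energy a f) p := by
  have h : ∀ i, DifferentiableAt ℝ (fun x => _root_.flux a f i x * f i x) p :=
    fun i => (DifferentiableAt.flux ha hf i).mul (hf i)
  exact DifferentiableAt.fun_sum fun j _ => h j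

theorem dirDeriv_flux (ha : ∀ i j, DifferentiableAt ℝ (a i j) p)
    (hf : ∀ i, DifferentiableAt ℝ (f i) p) (i : Fin n) :
    dirDeriv v (flux a f i) p =
      ∑ j, (dirDeriv v (a i j) p * f j p + a i j p * dirDeriv v (f j) p) := by
  have h : ∀ j, DifferentiableAt ℝ (fun x => a i j x * f j x) p := fun j => (ha i j).mul (hf j)
  change dirDeriv v (fun x => ∑ j, a i j x * f j x) p = _
  rw [dirDeriv_sum _ h]
  refine Finset.sum_congr rfl fun j _ => ?_
  rw [dirDeriv_mul (ha i j) (hf j)]; ring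

theorem dirDeriv_energy (ha : ∀ i j, DifferentiableAt ℝ (a i j) p)
    (hs : ∀ i j, a i j p = a j i p) (hf : ∀ i, DifferentiableAt ℝ (f i) p) :
    dirDeriv v (energy a f) p =
      (∑ i, ∑ j, dirDeriv v (a i j) p * f i p * f j p)
        + 2 * ∑ i, flux a f i p * dirDeriv v (f i) p := by
  have h : ∀ i, DifferentiableAt ℝ (fun x => flux a f i x * f i x) p :=
    fun i => (DifferentiableAt.flux ha hf i).mul (hf i)
  change dirDeriv v (fun x => ∑ i, flux a f i x * f i x) p = _
  rw [dirDeriv_sum _ h]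
  have h1 : ∑ i, ∑ j, a i j p * dirDeriv v (f j) p * f i p
      = ∑ i, flux a f i p * dirDeriv v (f i) p := by
    rw [Finset.sum_comm]
    refine Finset.sum_congr rfl fun i _ => ?_
    rw [flux, Finset.sum_mul]
    refine Finset.sum_congr rfl fun j _ => ?_
    rw [hs j i]; ring
  rw [two_mul, ← add_assoc]
  nth_rewrite 1 [← h1]
  rw [← Finset.sum_add_distrib, ← Finset.sum_add_distrib]
  refine Finset.sum_congr rfl fun i _ => ?_
  rw [dirDeriv_mul (DifferentiableAt.flux ha hf i) (hf i), dirDeriv_flux ha hf,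
    ← Finset.sum_add_distrib, Finset.mul_sum, add_comm]
  congr 1
  refine Finset.sum_congr rfl fun j _ => ?_
  ring

theorem frameDiv_mul {q : Fin n → X → ℝ} {c : X → ℝ} (hq : ∀ i, DifferentiableAt ℝ (q i) p)
    (hc : DifferentiableAt ℝ c p) :
    frameDiv e (fun i x => c x * q i x) p =
      c p * frameDiv e q p + ∑ i, q i p * dirDeriv (e i) c p := by
  rw [frameDiv, frameDiv, Finset.mul_sum, ← Finset.sum_add_distrib]
  exact Finset.sum_congr rfl fun i _ => dirDeriv_mul hc (hq i)

theorem frameDiv_add {q q' : Fin n → X → ℝ} (hq : ∀ i, DifferentiableAt ℝ (q i) p)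
    (hq' : ∀ i, DifferentiableAt ℝ (q' i) p) :
    frameDiv e (fun i x => q i x + q' i x) p = frameDiv e q p + frameDiv e q' p := by
  rw [frameDiv, frameDiv, frameDiv, ← Finset.sum_add_distrib]
  exact Finset.sum_congr rfl fun i _ => dirDeriv_add (hq i) (hq' i)

/-- The Carleman identity: twice the product of the symmetric and the antisymmetric part of the
conjugated operator is a divergence plus quadratic terms. -/
theorem carleman_identity (ha : ∀ i j, DifferentiableAt ℝ (a i j) p)
    (hs : ∀ i j, a i j p = a j i p) (hΨ : ContDiff ℝ ∞ Ψ) (hu : ContDiff ℝ ∞ u)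
    (hW : ContDiff ℝ ∞ W) :
    frameDiv e (carlemanSpaceField a e τ Ψ u W) p
        + dirDeriv τ (carlemanTimeField a e τ Ψ u) p =
      2 * (frameDiv e (flux a (frameGrad e u)) p + conjPotential a e τ Ψ p * u p)
          * (dirDeriv τ u p - 2 * (∑ k, flux a (frameGrad e Ψ) k p * frameGrad e u k p)
            - frameDiv e (flux a (frameGrad e Ψ)) p * u p)
        + 2 * frameDiv e (flux a (frameGrad e u)) p
            * (frameDiv e (flux a (frameGrad e Ψ)) p - hessTrace a e Ψ p) * u p
        - (∑ i, ∑ j, dirDeriv τ (a i j) p * frameGrad e u i p * frameGrad e u j p)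
        - 4 * (∑ i, flux a (frameGrad e u) i p *
            ∑ k, dirDeriv (e i) (flux a (frameGrad e Ψ) k) p * frameGrad e u k p)
        + 2 * (∑ k, flux a (frameGrad e Ψ) k p *
            ∑ i, ∑ j, dirDeriv (e k) (a i j) p * frameGrad e u i p * frameGrad e u j p)
        + 2 * (frameDiv e (flux a (frameGrad e Ψ)) p - hessTrace a e Ψ p)
            * energy a (frameGrad e u) p
        - 2 * u p * (∑ i, flux a (frameGrad e u) i p * dirDeriv (e i) (hessTrace a e Ψ) p)
        + dirDeriv τ (conjPotential a e τ Ψ) p * u p ^ 2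
        - 2 * (∑ i, flux a (frameGrad e Ψ) i p * dirDeriv (e i) (conjPotential a e τ Ψ) p) * u p ^ 2
        + W p * u p * frameDiv e (flux a (frameGrad e u)) p
        + W p * energy a (frameGrad e u) p
        + u p * (∑ i, flux a (frameGrad e u) i p * dirDeriv (e i) W p) := by
  have dif : ∀ {f : X → ℝ}, ContDiff ℝ ∞ f → DifferentiableAt ℝ f p :=
    fun h => (h.differentiable (by simp)) p
  have hgu : ∀ i, DifferentiableAt ℝ (frameGrad e u i) p := fun i => dif (hu.dirDeriv _)
  have hgΨ : ∀ i, DifferentiableAt ℝ (frameGrad e Ψ i) p := fun i => dif (hΨ.dirDeriv _)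
  have hq := DifferentiableAt.flux ha hgu
  have hb := DifferentiableAt.flux ha hgΨ
  have hQ := DifferentiableAt.energy ha hgu
  have hF : DifferentiableAt ℝ (conjPotential a e τ Ψ) p :=
    (DifferentiableAt.energy ha hgΨ).sub (dif (hΨ.dirDeriv τ))
  have hG : DifferentiableAt ℝ (hessTrace a e Ψ) p := by
    have h : ∀ i j, DifferentiableAt ℝ
        (fun x => a i j x * dirDeriv (e i) (dirDeriv (e j) Ψ) x) p :=
      fun i j => (ha i j).mul (dif ((hΨ.dirDeriv _).dirDeriv _))
    exact DifferentiableAt.fun_sum fun i _ => DifferentiableAt.fun_sum fun j _ => h i j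
  have hut := dif (hu.dirDeriv τ)
  have hu' := dif hu
  have hW' := dif hW
  have hB : DifferentiableAt ℝ
      (fun x => ∑ k, flux a (frameGrad e Ψ) k x * frameGrad e u k x) p := by
    have h : ∀ k, DifferentiableAt ℝ (fun x => flux a (frameGrad e Ψ) k x * frameGrad e u k x) p :=
      fun k => (hb k).mul (hgu k)
    exact DifferentiableAt.fun_sum fun k _ => h k
  have hdB : ∀ i, dirDeriv (e i) (fun x => ∑ k, flux a (frameGrad e Ψ) k x * frameGrad e u k x) p
      = (∑ k, dirDeriv (e i) (flux a (frameGrad e Ψ) k) p * frameGrad e u k p)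
        + ∑ k, flux a (frameGrad e Ψ) k p * dirDeriv (e i) (frameGrad e u k) p := by
    intro i
    have h : ∀ k, DifferentiableAt ℝ (fun x => flux a (frameGrad e Ψ) k x * frameGrad e u k x) p :=
      fun k => (hb k).mul (hgu k)
    rw [dirDeriv_sum _ h, ← Finset.sum_add_distrib]
    refine Finset.sum_congr rfl fun k _ => ?_
    rw [dirDeriv_mul (hb k) (hgu k)]; ring
  set q := flux a (frameGrad e u) with hqdef
  set b := flux a (frameGrad e Ψ) with hbdef
  set Q := energy a (frameGrad e u) with hQdef
  set F := conjPotential a e τ Ψ with hFdef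
  set G := hessTrace a e Ψ with hGdef
  -- Grouping by the fluxes `q` and `b` means that each is differentiated only through its
  -- divergence, while the scalar factors carry the other derivatives.
  have hfield : carlemanSpaceField a e τ Ψ u W = fun i x =>
      ((2 * dirDeriv τ u x - 4 * (∑ k, b k x * frameGrad e u k x) - 2 * (G x * u x) + W x * u x)
        * q i x) + ((2 * Q x - 2 * (F x * (u x * u x))) * b i x) := by
    funext i x
    simp only [carlemanSpaceField, ← hqdef, ← hbdef, ← hQdef, ← hFdef, ← hGdef]
    ring
  have h1 := hut.const_mul 2
  have h2 := hB.const_mul 4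
  have h12 := h1.fun_sub h2
  have h3 := (hG.fun_mul hu').const_mul 2
  have h123 := h12.fun_sub h3
  have h4 := hW'.fun_mul hu'
  have h1234 := h123.fun_add h4
  have h5 := hQ.const_mul 2
  have h6 := (hF.fun_mul (hu'.fun_mul hu')).const_mul 2
  have h56 := h5.fun_sub h6
  have d1 : ∀ i, dirDeriv (e i) (fun x => 2 * dirDeriv τ u x
      - 4 * (∑ k, b k x * frameGrad e u k x) - 2 * (G x * u x) + W x * u x) p
      = 2 * dirDeriv (e i) (dirDeriv τ u) p
        - 4 * ((∑ k, dirDeriv (e i) (b k) p * frameGrad e u k p)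
          + ∑ k, b k p * dirDeriv (e i) (frameGrad e u k) p)
        - 2 * (G p * frameGrad e u i p + u p * dirDeriv (e i) G p)
        + (W p * frameGrad e u i p + u p * dirDeriv (e i) W p) := by
    intro i
    rw [dirDeriv_add h123 h4, dirDeriv_sub h12 h3, dirDeriv_sub h1 h2,
      dirDeriv_const_mul _ hut, dirDeriv_const_mul _ hB, hdB,
      dirDeriv_const_mul _ (hG.fun_mul hu'), dirDeriv_mul hG hu', dirDeriv_mul hW' hu']
    rfl
  have d2 : ∀ i, dirDeriv (e i) (fun x => 2 * Q x - 2 * (F x * (u x * u x))) p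
      = 2 * ((∑ k, ∑ j, dirDeriv (e i) (a k j) p * frameGrad e u k p * frameGrad e u j p)
        + 2 * ∑ k, q k p * dirDeriv (e i) (frameGrad e u k) p)
        - 2 * (F p * (2 * u p * frameGrad e u i p) + u p ^ 2 * dirDeriv (e i) F p) := by
    intro i
    rw [dirDeriv_sub h5 h6, dirDeriv_const_mul _ hQ, dirDeriv_const_mul _ (hF.fun_mul (hu'.fun_mul hu')),
      dirDeriv_mul hF (hu'.fun_mul hu'), dirDeriv_mul hu' hu', dirDeriv_energy ha hs hgu]
    simp only [frameGrad]
    ring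
  have d3 : dirDeriv τ (carlemanTimeField a e τ Ψ u) p
      = F p * (2 * u p * dirDeriv τ u p) + u p ^ 2 * dirDeriv τ F p
        - ((∑ k, ∑ j, dirDeriv τ (a k j) p * frameGrad e u k p * frameGrad e u j p)
        + 2 * ∑ k, q k p * dirDeriv τ (frameGrad e u k) p) := by
    change dirDeriv τ (fun x => F x * (u x * u x) - Q x) p = _
    rw [dirDeriv_sub (hF.fun_mul (hu'.fun_mul hu')) hQ,
      dirDeriv_mul hF (hu'.fun_mul hu'), dirDeriv_mul hu' hu', dirDeriv_energy ha hs hgu]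
    ring
  -- The two commutation rules cancel the second derivatives of `u` that are not part of div(A∇u):
  -- those from `∂_t u` against the time derivative of the energy, and those from A∇Ψ·∇u against the
  -- spatial derivatives of the energy.
  have comm1 : ∑ k, q k p * dirDeriv τ (frameGrad e u k) p
      = ∑ k, q k p * dirDeriv (e k) (dirDeriv τ u) p :=
    Finset.sum_congr rfl fun k _ => by rw [frameGrad, dirDeriv_comm hu]
  have comm2 : ∑ i, b i p * ∑ k, q k p * dirDeriv (e i) (frameGrad e u k) p
      = ∑ i, q i p * ∑ k, b k p * dirDeriv (e i) (frameGrad e u k) p := by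
    simp only [Finset.mul_sum]
    rw [Finset.sum_comm]
    refine Finset.sum_congr rfl fun i _ => Finset.sum_congr rfl fun k _ => ?_
    rw [frameGrad, frameGrad, dirDeriv_comm hu]; ring
  have hQp : ∑ i, q i p * frameGrad e u i p = Q p := rfl
  rw [hfield, frameDiv_add (fun i => h1234.fun_mul (hq i)) (fun i => h56.fun_mul (hb i)),
    frameDiv_mul hq h1234, frameDiv_mul hb h56, d3]
  simp only [d1, d2]
  have s1 : ∑ i, q i p * (2 * dirDeriv (e i) (dirDeriv τ u) p
        - 4 * ((∑ k, dirDeriv (e i) (b k) p * frameGrad e u k p)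
          + ∑ k, b k p * dirDeriv (e i) (frameGrad e u k) p)
        - 2 * (G p * frameGrad e u i p + u p * dirDeriv (e i) G p)
        + (W p * frameGrad e u i p + u p * dirDeriv (e i) W p))
      = 2 * (∑ i, q i p * dirDeriv (e i) (dirDeriv τ u) p)
        - 4 * (∑ i, q i p * ∑ k, dirDeriv (e i) (b k) p * frameGrad e u k p)
        - 4 * (∑ i, q i p * ∑ k, b k p * dirDeriv (e i) (frameGrad e u k) p)
        + (W p - 2 * G p) * (∑ i, q i p * frameGrad e u i p)
        - 2 * u p * (∑ i, q i p * dirDeriv (e i) G p)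
        + u p * (∑ i, q i p * dirDeriv (e i) W p) := by
    rw [Finset.mul_sum, Finset.mul_sum, Finset.mul_sum, Finset.mul_sum, Finset.mul_sum,
      Finset.mul_sum, ← Finset.sum_sub_distrib, ← Finset.sum_sub_distrib, ← Finset.sum_add_distrib,
      ← Finset.sum_sub_distrib, ← Finset.sum_add_distrib]
    exact Finset.sum_congr rfl fun i _ => by ring
  have s2 : ∑ i, b i p * (2 * ((∑ k, ∑ j, dirDeriv (e i) (a k j) p * frameGrad e u k p
        * frameGrad e u j p) + 2 * ∑ k, q k p * dirDeriv (e i) (frameGrad e u k) p)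
        - 2 * (F p * (2 * u p * frameGrad e u i p) + u p ^ 2 * dirDeriv (e i) F p))
      = 2 * (∑ i, b i p * ∑ k, ∑ j, dirDeriv (e i) (a k j) p * frameGrad e u k p
          * frameGrad e u j p)
        + 4 * (∑ i, b i p * ∑ k, q k p * dirDeriv (e i) (frameGrad e u k) p)
        - 4 * F p * u p * (∑ i, b i p * frameGrad e u i p)
        - 2 * u p ^ 2 * (∑ i, b i p * dirDeriv (e i) F p) := by
    rw [Finset.mul_sum, Finset.mul_sum, Finset.mul_sum, Finset.mul_sum,
      ← Finset.sum_add_distrib, ← Finset.sum_sub_distrib, ← Finset.sum_sub_distrib]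
    exact Finset.sum_congr rfl fun i _ => by ring
  rw [s1, s2, comm1, comm2, hQp]
  ring

end Divergence

/-! ### Crude bounds for finite sums and coercive matrices. -/

section FiniteSums

variable {n : ℕ}

theorem abs_sum_fin_le {f : Fin n → ℝ} {C : ℝ} (h : ∀ i, |f i| ≤ C) : |∑ i, f i| ≤ n * C := by
  refine (Finset.abs_sum_le_sum_abs _ _).trans ((Finset.sum_le_sum fun i _ => h i).trans ?_)
  simp

theorem abs_mul_le_mul {x y C D : ℝ} (hx : |x| ≤ C) (hy : |y| ≤ D) : |x * y| ≤ C * D := by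
  rw [abs_mul]
  exact mul_le_mul hx hy (abs_nonneg _) ((abs_nonneg _).trans hx)

theorem abs_bilinear_le {c : Fin n → Fin n → ℝ} {f g : Fin n → ℝ} {C F G : ℝ}
    (hc : ∀ i j, |c i j| ≤ C) (hf : ∀ i, |f i| ≤ F) (hg : ∀ i, |g i| ≤ G) :
    |∑ i, ∑ j, c i j * f i * g j| ≤ n ^ 2 * (C * F * G) := by
  have := abs_sum_fin_le fun i => abs_sum_fin_le fun j =>
    abs_mul_le_mul (abs_mul_le_mul (hc i j) (hf i)) (hg j)
  calc _ ≤ _ := this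
    _ = _ := by ring

theorem abs_le_sqrt_sum_sq (ξ : Fin n → ℝ) (i : Fin n) : |ξ i| ≤ √(∑ j, ξ j ^ 2) := by
  refine Real.abs_le_sqrt ?_
  exact Finset.single_le_sum (f := fun j => ξ j ^ 2) (fun j _ => sq_nonneg _) (Finset.mem_univ i)

/-- A coercive matrix expands lengths. -/
theorem sq_mul_sum_sq_le_of_coercive {a : Fin n → Fin n → ℝ} {lam : ℝ} (hl : 0 < lam)
    (ξ : Fin n → ℝ) (h : lam * ∑ i, ξ i ^ 2 ≤ ∑ i, ∑ j, a i j * ξ i * ξ j) :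
    lam ^ 2 * ∑ i, ξ i ^ 2 ≤ ∑ i, (∑ j, a i j * ξ j) ^ 2 := by
  have e : ∑ i, ∑ j, a i j * ξ i * ξ j = ∑ i, ξ i * ∑ j, a i j * ξ j := by
    refine Finset.sum_congr rfl fun i _ => ?_
    rw [Finset.mul_sum]
    exact Finset.sum_congr rfl fun j _ => by ring
  rw [e] at h
  -- Cauchy–Schwarz: λ|ξ|² ≤ ξ·Aξ ≤ |ξ||Aξ|. One factor |ξ|² is cancelled at the end, hence the
  -- separate case |ξ| = 0.
  have hcs := Finset.sum_mul_sq_le_sq_mul_sq Finset.univ ξ (fun i => ∑ j, a i j * ξ j)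
  set S := ∑ i, ξ i ^ 2
  set T := ∑ i, (∑ j, a i j * ξ j) ^ 2
  set Z := ∑ i, ξ i * ∑ j, a i j * ξ j
  have hS : 0 ≤ S := Finset.sum_nonneg fun i _ => sq_nonneg _
  have hT : 0 ≤ T := Finset.sum_nonneg fun i _ => sq_nonneg _
  rcases hS.eq_or_lt with h0 | h0
  · rw [← h0]; simpa using hT
  · have h1 : (lam * S) ^ 2 ≤ S * T := (pow_le_pow_left₀ (by positivity) h 2).trans hcs
    have h2 : S * (lam ^ 2 * S) ≤ S * T := by linarith [h1, mul_pow lam S 2, sq S]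
    exact le_of_mul_le_mul_left h2 h0

end FiniteSums

/-! ### Estimates of the individual terms of the identity at a point. -/

section Pointwise

variable {X : Type*} [NormedAddCommGroup X] [NormedSpace ℝ X] {n : ℕ}

/-- The pointwise bounds on the coefficients `a` and the weight `Ψ` that enter the Carleman
inequality. Here `r = |x|`, `m = (R / r) ^ (2/3)`, and `s` is the time derivative of the cut-off. -/
structure CarlemanPoint (a : Fin n → Fin n → X → ℝ) (e : Fin n → X) (τ : X) (Ψ : X → ℝ) (p : X)
    (lam Lam M E γ m r R K s : ℝ) : Prop where
  diff : ∀ i j, DifferentiableAt ℝ (a i j) p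
  symm : ∀ i j, a i j p = a j i p
  coercive : ∀ ξ : Fin n → ℝ, lam * ∑ i, ξ i ^ 2 ≤ ∑ i, ∑ j, a i j p * ξ i * ξ j
  upper : ∀ ξ : Fin n → ℝ, ∑ i, ∑ j, a i j p * ξ i * ξ j ≤ Lam * ∑ i, ξ i ^ 2
  abs_coeff : ∀ i j, |a i j p| ≤ Lam
  abs_deriv : ∀ k i j, |dirDeriv (e k) (a i j) p| ≤ E / r
  abs_time : ∀ i j, |dirDeriv τ (a i j) p| ≤ M
  smooth : ContDiff ℝ ∞ Ψ
  abs_grad : ∀ k, |frameGrad e Ψ k p| ≤ 2 * γ * m * r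
  grad_lower : γ ^ 2 * m ^ 2 * r ^ 2 / 36 ≤ ∑ k, frameGrad e Ψ k p ^ 2
  grad_upper : ∑ k, frameGrad e Ψ k p ^ 2 ≤ 4 * γ ^ 2 * m ^ 2 * r ^ 2
  convex : ∀ q : Fin n → ℝ,
    γ * m / 18 * ∑ i, q i ^ 2 ≤ ∑ i, ∑ j, dirDeriv (e i) (dirDeriv (e j) Ψ) p * q i * q j
  abs_hess : ∀ i j, |dirDeriv (e i) (dirDeriv (e j) Ψ) p| ≤ 4 * γ * m
  abs_third : ∀ k i j, |dirDeriv (e k) (dirDeriv (e i) (dirDeriv (e j) Ψ)) p| ≤ 6 * γ * m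
  abs_mixed : ∀ k, |dirDeriv τ (dirDeriv (e k) Ψ) p| ≤ 2 * γ * m * r
  time : |dirDeriv τ Ψ p - s * R ^ 2| ≤ γ * m * r ^ 2
  abs_time_time : |dirDeriv τ (dirDeriv τ Ψ) p| ≤ K * R ^ 2
  one_le_m : 1 ≤ m
  one_le_r : 1 ≤ r
  one_le_γ : 1 ≤ γ
  radius : m ^ 3 * r ^ 2 = R ^ 2
  m_le : m ≤ R
  mr_le : m * r ≤ R
  lam_pos : 0 < lam
  lam_le : lam ≤ Lam
  E_pos : 0 < E
  E_le : E ≤ 1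
  M_pos : 0 < M
  K_nonneg : 0 ≤ K

namespace CarlemanPoint

variable {a : Fin n → Fin n → X → ℝ} {e : Fin n → X} {τ : X} {Ψ u : X → ℝ} {p : X}
  {lam Lam M E γ m r R K s : ℝ} {f : Fin n → X → ℝ} {ρ : ℝ}

theorem energy_eq {X : Type*} (a : Fin n → Fin n → X → ℝ) (f : Fin n → X → ℝ) (p : X) :
    energy a f p = ∑ i, ∑ j, a i j p * f i p * f j p := by
  refine Finset.sum_congr rfl fun i _ => ?_
  rw [flux, Finset.sum_mul]
  exact Finset.sum_congr rfl fun j _ => by ring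

theorem energy_nonneg (h : CarlemanPoint a e τ Ψ p lam Lam M E γ m r R K s) :
    0 ≤ energy a f p := by
  rw [energy_eq]
  refine le_trans ?_ (h.coercive fun i => f i p)
  exact mul_nonneg h.lam_pos.le (Finset.sum_nonneg fun i _ => sq_nonneg _)

theorem energy_le (h : CarlemanPoint a e τ Ψ p lam Lam M E γ m r R K s) :
    energy a f p ≤ Lam * ∑ i, f i p ^ 2 := by
  rw [energy_eq]; exact h.upper fun i => f i p

theorem Lam_pos (h : CarlemanPoint a e τ Ψ p lam Lam M E γ m r R K s) : 0 < Lam :=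
  h.lam_pos.trans_le h.lam_le

theorem abs_flux_le (h : CarlemanPoint a e τ Ψ p lam Lam M E γ m r R K s)
    (hf : ∀ i, |f i p| ≤ ρ) (i : Fin n) : |flux a f i p| ≤ n * (Lam * ρ) :=
  abs_sum_fin_le fun j => abs_mul_le_mul (h.abs_coeff i j) (hf j)

theorem sq_flux_ge (h : CarlemanPoint a e τ Ψ p lam Lam M E γ m r R K s) :
    lam ^ 2 * ∑ i, f i p ^ 2 ≤ ∑ i, flux a f i p ^ 2 :=
  sq_mul_sum_sq_le_of_coercive h.lam_pos (fun i => f i p) (h.coercive _)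

theorem differentiableAt_of_contDiff {g : X → ℝ} (hg : ContDiff ℝ ∞ g) :
    DifferentiableAt ℝ g p := hg.differentiable (by simp) p

/-- The difference is ∑ ∂_i a_ij ∂_jΨ; the decay E/r of the coefficients exactly compensates the
growth γmr of the gradient of the weight. -/
theorem abs_frameDiv_sub_hessTrace_le (h : CarlemanPoint a e τ Ψ p lam Lam M E γ m r R K s) :
    |frameDiv e (flux a (frameGrad e Ψ)) p - hessTrace a e Ψ p| ≤ 2 * n ^ 2 * E * (γ * m) := by
  have hr := h.one_le_r
  have hd : ∀ i, DifferentiableAt ℝ (frameGrad e Ψ i) p :=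
    fun i => differentiableAt_of_contDiff (h.smooth.dirDeriv _)
  have e1 : frameDiv e (flux a (frameGrad e Ψ)) p - hessTrace a e Ψ p
      = ∑ i, ∑ j, dirDeriv (e i) (a i j) p * frameGrad e Ψ j p := by
    rw [frameDiv, hessTrace, ← Finset.sum_sub_distrib]
    refine Finset.sum_congr rfl fun i _ => ?_
    rw [dirDeriv_flux h.diff hd, ← Finset.sum_sub_distrib]
    refine Finset.sum_congr rfl fun j _ => ?_
    simp only [frameGrad]; ring
  rw [e1]
  refine (abs_sum_fin_le fun i => abs_sum_fin_le fun j =>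
    abs_mul_le_mul (h.abs_deriv i i j) (h.abs_grad j)).trans (le_of_eq ?_)
  field_simp

/-- Differentiating A∇Ψ gives D²Ψ(Af, Af), where convexity and |Af| ≥ λ|f| produce the factor λ²,
and a remainder containing ∂A, again of size Eγm. -/
theorem frame_hessian_term_ge (h : CarlemanPoint a e τ Ψ p lam Lam M E γ m r R K s)
    (hρ : ∀ i, |f i p| ≤ ρ) :
    lam ^ 2 * (γ * m) / 18 * (∑ i, f i p ^ 2) - 2 * n ^ 4 * Lam * E * (γ * m) * ρ ^ 2 ≤
      ∑ i, flux a f i p * ∑ k, dirDeriv (e i) (flux a (frameGrad e Ψ) k) p * f k p := by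
  have hr := h.one_le_r
  have hγm : 0 ≤ γ * m := mul_nonneg (by linarith [h.one_le_γ]) (by linarith [h.one_le_m])
  have hd : ∀ i, DifferentiableAt ℝ (frameGrad e Ψ i) p :=
    fun i => differentiableAt_of_contDiff (h.smooth.dirDeriv _)
  have e1 : ∑ i, flux a f i p * ∑ k, dirDeriv (e i) (flux a (frameGrad e Ψ) k) p * f k p
      = (∑ i, ∑ j, dirDeriv (e i) (dirDeriv (e j) Ψ) p * flux a f i p * flux a f j p)
        + ∑ i, flux a f i p * ∑ k, ∑ l,
          dirDeriv (e i) (a k l) p * frameGrad e Ψ l p * f k p := by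
    rw [← Finset.sum_add_distrib]
    refine Finset.sum_congr rfl fun i _ => ?_
    have e2 : ∑ j, dirDeriv (e i) (dirDeriv (e j) Ψ) p * flux a f i p * flux a f j p
        = flux a f i p * ∑ k, ∑ j, a k j p * dirDeriv (e i) (dirDeriv (e j) Ψ) p * f k p := by
      rw [Finset.sum_comm, Finset.mul_sum]
      refine Finset.sum_congr rfl fun j _ => ?_
      have hj : flux a f j p = ∑ k, a j k p * f k p := rfl
      rw [hj, Finset.mul_sum, Finset.mul_sum]
      refine Finset.sum_congr rfl fun k _ => ?_
      rw [h.symm k j]; ring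
    rw [e2, ← mul_add, ← Finset.sum_add_distrib]
    congr 1
    refine Finset.sum_congr rfl fun k _ => ?_
    rw [dirDeriv_flux h.diff hd, Finset.sum_mul, ← Finset.sum_add_distrib]
    refine Finset.sum_congr rfl fun j _ => ?_
    simp only [frameGrad]; ring
  have b1 : |∑ i, flux a f i p * ∑ k, ∑ l,
      dirDeriv (e i) (a k l) p * frameGrad e Ψ l p * f k p|
      ≤ 2 * n ^ 4 * Lam * E * (γ * m) * ρ ^ 2 := by
    refine (abs_sum_fin_le fun i => abs_mul_le_mul (h.abs_flux_le hρ i)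
      (abs_sum_fin_le fun k => abs_sum_fin_le fun l =>
        abs_mul_le_mul (abs_mul_le_mul (h.abs_deriv i k l) (h.abs_grad l)) (hρ k))).trans
        (le_of_eq ?_)
    field_simp
  have b2 := h.convex fun i => flux a f i p
  have b3 : γ * m / 18 * (lam ^ 2 * ∑ i, f i p ^ 2) ≤ γ * m / 18 * ∑ i, flux a f i p ^ 2 :=
    mul_le_mul_of_nonneg_left h.sq_flux_ge (by positivity)
  rw [e1]
  have := (abs_le.1 b1).1
  linarith

theorem abs_flux_mul_deriv_form_le (h : CarlemanPoint a e τ Ψ p lam Lam M E γ m r R K s)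
    (hρ : ∀ i, |f i p| ≤ ρ) :
    |∑ k, flux a (frameGrad e Ψ) k p * ∑ i, ∑ j, dirDeriv (e k) (a i j) p * f i p * f j p|
      ≤ 2 * n ^ 4 * Lam * E * (γ * m) * ρ ^ 2 := by
  have hr := h.one_le_r
  refine (abs_sum_fin_le fun k => abs_mul_le_mul (h.abs_flux_le h.abs_grad k)
    (abs_bilinear_le (h.abs_deriv k) hρ hρ)).trans (le_of_eq ?_)
  field_simp

/-- A cross term of u and ∇u, to be split by Young's inequality. Here E ≤ 1 suffices, since the
resulting u² term is of lower order in γ. -/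
theorem abs_flux_mul_deriv_hessTrace_le (h : CarlemanPoint a e τ Ψ p lam Lam M E γ m r R K s)
    (hρ : ∀ i, |f i p| ≤ ρ) :
    |∑ i, flux a f i p * dirDeriv (e i) (hessTrace a e Ψ) p|
      ≤ n ^ 4 * Lam * (4 + 6 * Lam) * (γ * m) * ρ := by
  have hr := h.one_le_r
  have hL := h.Lam_pos
  have hγm : 0 ≤ γ * m := mul_nonneg (by linarith [h.one_le_γ]) (by linarith [h.one_le_m])
  have hd : ∀ i j, DifferentiableAt ℝ (dirDeriv (e i) (dirDeriv (e j) Ψ)) p :=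
    fun i j => differentiableAt_of_contDiff ((h.smooth.dirDeriv _).dirDeriv _)
  have hd' : ∀ i j, DifferentiableAt ℝ (fun x => a i j x * dirDeriv (e i) (dirDeriv (e j) Ψ) x) p :=
    fun i j => (h.diff i j).mul (hd i j)
  have hEr : E / r ≤ 1 := (div_le_one (by linarith)).2 (h.E_le.trans hr)
  have b : ∀ k, |dirDeriv (e k) (hessTrace a e Ψ) p| ≤ n * (n * ((4 + 6 * Lam) * (γ * m))) := by
    intro k
    have e1 : dirDeriv (e k) (hessTrace a e Ψ) p = ∑ i, ∑ j,
        (a i j p * dirDeriv (e k) (dirDeriv (e i) (dirDeriv (e j) Ψ)) p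
          + dirDeriv (e i) (dirDeriv (e j) Ψ) p * dirDeriv (e k) (a i j) p) := by
      change dirDeriv (e k) (fun x => ∑ i, ∑ j, a i j x * dirDeriv (e i) (dirDeriv (e j) Ψ) x) p = _
      rw [dirDeriv_sum _ fun i => DifferentiableAt.fun_sum fun j _ => hd' i j]
      refine Finset.sum_congr rfl fun i _ => ?_
      rw [dirDeriv_sum _ (hd' i)]
      exact Finset.sum_congr rfl fun j _ => dirDeriv_mul (h.diff i j) (hd i j)
    rw [e1]
    refine abs_sum_fin_le fun i => abs_sum_fin_le fun j => (abs_add_le _ _).trans ?_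
    have h1 := abs_mul_le_mul (h.abs_coeff i j) (h.abs_third k i j)
    have h2 := abs_mul_le_mul (h.abs_hess i j) ((h.abs_deriv k i j).trans hEr)
    linarith
  refine (abs_sum_fin_le fun i => abs_mul_le_mul (h.abs_flux_le hρ i) (b i)).trans (le_of_eq ?_)
  ring

/-- The source of the γ³R² term: the derivative of A∇Ψ·∇Ψ along A∇Ψ contains 2 D²Ψ(A∇Ψ, A∇Ψ), at
least of order λ²γm(γmr)² = λ²γ³R². The constant is 2/(18·36) = 1/324. The mixed derivatives ∂_t∇Ψ
have only γ². -/
theorem flux_mul_deriv_conjPotential_ge (h : CarlemanPoint a e τ Ψ p lam Lam M E γ m r R K s) :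
    lam ^ 2 * (γ ^ 3 * R ^ 2) / 324 - 8 * n ^ 4 * Lam * E * (γ ^ 3 * R ^ 2)
        - 4 * n ^ 2 * Lam * (γ ^ 2 * R ^ 2) ≤
      ∑ i, flux a (frameGrad e Ψ) i p * dirDeriv (e i) (conjPotential a e τ Ψ) p := by
  have hr := h.one_le_r
  have hL := h.Lam_pos
  have hm := h.one_le_m
  have hγ := h.one_le_γ
  have hd : ∀ i, DifferentiableAt ℝ (frameGrad e Ψ i) p :=
    fun i => differentiableAt_of_contDiff (h.smooth.dirDeriv _)
  have e1 : ∀ k, dirDeriv (e k) (conjPotential a e τ Ψ) p =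
      (∑ i, ∑ j, dirDeriv (e k) (a i j) p * frameGrad e Ψ i p * frameGrad e Ψ j p)
        + 2 * (∑ i, flux a (frameGrad e Ψ) i p * dirDeriv (e k) (dirDeriv (e i) Ψ) p)
        - dirDeriv τ (dirDeriv (e k) Ψ) p := by
    intro k
    change dirDeriv (e k) (fun x => energy a (frameGrad e Ψ) x - dirDeriv τ Ψ x) p = _
    rw [dirDeriv_sub (DifferentiableAt.energy h.diff hd)
      (differentiableAt_of_contDiff (h.smooth.dirDeriv _)), dirDeriv_energy h.diff h.symm hd,
      dirDeriv_comm h.smooth]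
    rfl
  have e2 : ∑ i, flux a (frameGrad e Ψ) i p * dirDeriv (e i) (conjPotential a e τ Ψ) p
      = (∑ k, flux a (frameGrad e Ψ) k p *
          ∑ i, ∑ j, dirDeriv (e k) (a i j) p * frameGrad e Ψ i p * frameGrad e Ψ j p)
        + 2 * (∑ i, ∑ j, dirDeriv (e i) (dirDeriv (e j) Ψ) p
          * flux a (frameGrad e Ψ) i p * flux a (frameGrad e Ψ) j p)
        - ∑ k, flux a (frameGrad e Ψ) k p * dirDeriv τ (dirDeriv (e k) Ψ) p := by
    rw [Finset.mul_sum, ← Finset.sum_add_distrib, ← Finset.sum_sub_distrib]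
    refine Finset.sum_congr rfl fun k _ => ?_
    rw [e1, mul_sub, mul_add]
    congr 2
    rw [Finset.mul_sum, Finset.mul_sum, Finset.mul_sum]
    exact Finset.sum_congr rfl fun j _ => by ring
  have b1 := h.abs_flux_mul_deriv_form_le (f := frameGrad e Ψ) h.abs_grad
  have b1' : 2 * n ^ 4 * Lam * E * (γ * m) * (2 * γ * m * r) ^ 2
      = 8 * n ^ 4 * Lam * E * (γ ^ 3 * R ^ 2) := by rw [← h.radius]; ring
  have b2 : |∑ k, flux a (frameGrad e Ψ) k p * dirDeriv τ (dirDeriv (e k) Ψ) p|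
      ≤ 4 * n ^ 2 * Lam * (γ ^ 2 * R ^ 2) := by
    refine (abs_sum_fin_le fun k => abs_mul_le_mul (h.abs_flux_le h.abs_grad k)
      (h.abs_mixed k)).trans ?_
    have : (m * r) ^ 2 ≤ R ^ 2 := pow_le_pow_left₀ (by positivity) h.mr_le 2
    calc _ = 4 * n ^ 2 * Lam * (γ ^ 2 * (m * r) ^ 2) := by ring
      _ ≤ _ := by gcongr
  have b3 := h.convex fun i => flux a (frameGrad e Ψ) i p
  have b4 : γ * m / 18 * (lam ^ 2 * (γ ^ 2 * m ^ 2 * r ^ 2 / 36))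
      ≤ γ * m / 18 * ∑ i, flux a (frameGrad e Ψ) i p ^ 2 := by
    refine mul_le_mul_of_nonneg_left (le_trans ?_ h.sq_flux_ge) (by positivity)
    exact mul_le_mul_of_nonneg_left h.grad_lower (sq_nonneg _)
  have b5 : γ * m / 18 * (lam ^ 2 * (γ ^ 2 * m ^ 2 * r ^ 2 / 36))
      = lam ^ 2 * (γ ^ 3 * R ^ 2) / 648 := by rw [← h.radius]; ring
  rw [e2]
  have c1 := (abs_le.1 b1).1
  have c2 := (abs_le.1 b2).2
  rw [b1'] at c1
  linarith

theorem abs_time_conjPotential_le (h : CarlemanPoint a e τ Ψ p lam Lam M E γ m r R K s) :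
    |dirDeriv τ (conjPotential a e τ Ψ) p| ≤
      (4 * n ^ 2 * M + 8 * n ^ 2 * Lam + K) * (γ ^ 2 * R ^ 2) := by
  have hr := h.one_le_r
  have hL := h.Lam_pos
  have hm := h.one_le_m
  have hγ := h.one_le_γ
  have hM := h.M_pos
  have hK := h.K_nonneg
  have hd : ∀ i, DifferentiableAt ℝ (frameGrad e Ψ i) p :=
    fun i => differentiableAt_of_contDiff (h.smooth.dirDeriv _)
  have e1 : dirDeriv τ (conjPotential a e τ Ψ) p =
      (∑ i, ∑ j, dirDeriv τ (a i j) p * frameGrad e Ψ i p * frameGrad e Ψ j p)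
        + 2 * (∑ i, flux a (frameGrad e Ψ) i p * dirDeriv τ (dirDeriv (e i) Ψ) p)
        - dirDeriv τ (dirDeriv τ Ψ) p := by
    change dirDeriv τ (fun x => energy a (frameGrad e Ψ) x - dirDeriv τ Ψ x) p = _
    rw [dirDeriv_sub (DifferentiableAt.energy h.diff hd)
      (differentiableAt_of_contDiff (h.smooth.dirDeriv _)), dirDeriv_energy h.diff h.symm hd]
    rfl
  have hmr : (m * r) ^ 2 ≤ R ^ 2 := pow_le_pow_left₀ (by positivity) h.mr_le 2
  have b1 : |∑ i, ∑ j, dirDeriv τ (a i j) p * frameGrad e Ψ i p * frameGrad e Ψ j p|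
      ≤ 4 * n ^ 2 * M * (γ ^ 2 * R ^ 2) := by
    refine (abs_bilinear_le h.abs_time h.abs_grad h.abs_grad).trans ?_
    calc _ = 4 * n ^ 2 * M * (γ ^ 2 * (m * r) ^ 2) := by ring
      _ ≤ _ := by gcongr
  have b2 : |∑ k, flux a (frameGrad e Ψ) k p * dirDeriv τ (dirDeriv (e k) Ψ) p|
      ≤ 4 * n ^ 2 * Lam * (γ ^ 2 * R ^ 2) := by
    refine (abs_sum_fin_le fun k => abs_mul_le_mul (h.abs_flux_le h.abs_grad k)
      (h.abs_mixed k)).trans ?_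
    calc _ = 4 * n ^ 2 * Lam * (γ ^ 2 * (m * r) ^ 2) := by ring
      _ ≤ _ := by gcongr
  have b3 : K * R ^ 2 ≤ K * (γ ^ 2 * R ^ 2) := by
    have : 1 ≤ γ ^ 2 := one_le_pow₀ hγ
    have : 1 * R ^ 2 ≤ γ ^ 2 * R ^ 2 := mul_le_mul_of_nonneg_right this (sq_nonneg _)
    exact mul_le_mul_of_nonneg_left (by linarith) hK
  have b4 := h.abs_time_time
  rw [e1]
  rw [abs_le] at *
  constructor <;> linarith [b1.1, b1.2, b2.1, b2.2, b4.1, b4.2]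

/-- Once -ψ'R² is removed, the potential is harmless even after multiplication by γm, because m³r² =
R². The removed part is what the multiplier W has to handle. -/
theorem abs_conjPotential_add_le (h : CarlemanPoint a e τ Ψ p lam Lam M E γ m r R K s) :
    |conjPotential a e τ Ψ p + s * R ^ 2| * (γ * m) ≤
      4 * Lam * (γ ^ 3 * R ^ 2) + γ ^ 2 * R ^ 2 := by
  have hr := h.one_le_r
  have hL := h.Lam_pos
  have hm := h.one_le_m
  have hγ := h.one_le_γ
  have e1 := h.energy_nonneg (f := frameGrad e Ψ)
  have e2 : energy a (frameGrad e Ψ) p ≤ Lam * (4 * γ ^ 2 * m ^ 2 * r ^ 2) :=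
    h.energy_le.trans (mul_le_mul_of_nonneg_left h.grad_upper hL.le)
  have e3 := abs_le.1 h.time
  have b : |conjPotential a e τ Ψ p + s * R ^ 2|
      ≤ Lam * (4 * γ ^ 2 * m ^ 2 * r ^ 2) + γ * m * r ^ 2 := by
    rw [conjPotential, abs_le]
    have : 0 ≤ Lam * (4 * γ ^ 2 * m ^ 2 * r ^ 2) := by positivity
    constructor <;> linarith [e3.1, e3.2]
  have hmr : (m * r) ^ 2 ≤ R ^ 2 := pow_le_pow_left₀ (by positivity) h.mr_le 2
  calc _ ≤ (Lam * (4 * γ ^ 2 * m ^ 2 * r ^ 2) + γ * m * r ^ 2) * (γ * m) := by gcongr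
    _ = 4 * Lam * (γ ^ 3 * (m ^ 3 * r ^ 2)) + γ ^ 2 * (m * r) ^ 2 := by ring
    _ ≤ _ := by rw [h.radius]; gcongr

end CarlemanPoint

end Pointwise

/-! ### Absorption of the error terms. -/

/-- The smallness constant for the radial decay of the coefficients. -/
noncomputable def smallnessConst (n : ℕ) (Lam : ℝ) : ℝ :=
  486 * (16 * n ^ 4 * Lam + 32 * n ^ 2 * Lam)

/-- The constant that governs the lower order terms. -/
noncomputable def lowerOrderConst (n : ℕ) (lam Lam M K : ℝ) : ℝ :=
  486 * (n ^ 2 * M + (4 * n ^ 2 * M + 8 * n ^ 2 * Lam + K) + 8 * n ^ 2 * Lam + 16 * n ^ 4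
    + 12 * n ^ 2
    + 9 / 2 * ((2 * (n ^ 4 * Lam * (4 + 6 * Lam)) + 4 * n ^ 4 * Lam) ^ 2 / lam ^ 2))

set_option maxHeartbeats 1000000 in
/-- The algebra behind the pointwise Carleman inequality. -/
theorem carleman_scalar_inequality {N lam Lam M K E γ R G Y U κ L F τ h T1 T3 T4 T6 T8 T9 Q Ft W s σ
      H H2 : ℝ}
    (hlam : 0 < lam) (hLam : 0 ≤ Lam) (hE0 : 0 ≤ E) (hE1 : E ≤ 1) (_hN : 0 ≤ N)
    (hR : 0 < R) (hG : γ ≤ G) (hγ : 1 ≤ γ) (hH : H = γ * H2) (hGH : G ≤ H2) (hGG : G ^ 2 ≤ H2)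
    (hκ : κ = 4 * N ^ 2 * E)
    (hT1 : |T1| ≤ N ^ 2 * M * Y ^ 2)
    (hT3 : lam ^ 2 * G / 18 * Y ^ 2 - 2 * N ^ 4 * Lam * E * G * Y ^ 2 ≤ T3)
    (hT4 : |T4| ≤ 2 * N ^ 4 * Lam * E * G * Y ^ 2)
    (hh : |h| ≤ 2 * N ^ 2 * E * G) (hQ0 : 0 ≤ Q) (hQ : Q ≤ Lam * Y ^ 2)
    (hY : 0 ≤ Y)
    (hT6 : |T6| ≤ N ^ 4 * Lam * (4 + 6 * Lam) * G * Y)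
    (hFt : |Ft| ≤ (4 * N ^ 2 * M + 8 * N ^ 2 * Lam + K) * H2)
    (hT8 : lam ^ 2 * H / 324 - 8 * N ^ 4 * Lam * E * H - 4 * N ^ 2 * Lam * H2 ≤ T8)
    (hW : W = κ * G * σ) (hσ : |σ| ≤ 1) (hσs : |s| - 1 / R ^ 2 ≤ -(σ * s))
    (hT9 : |T9| ≤ N ^ 2 * Lam * (κ * G) * Y)
    (hF : |F + s * R ^ 2| * G ≤ 4 * Lam * H + H2)
    (hsmall : E * (486 * (16 * N ^ 4 * Lam + 32 * N ^ 2 * Lam)) ≤ lam ^ 2)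
    (hlarge : 486 * (N ^ 2 * M + (4 * N ^ 2 * M + 8 * N ^ 2 * Lam + K) + 8 * N ^ 2 * Lam
      + 16 * N ^ 4 + 12 * N ^ 2
      + 9 / 2 * ((2 * (N ^ 4 * Lam * (4 + 6 * Lam)) + 4 * N ^ 4 * Lam) ^ 2 / lam ^ 2))
        ≤ lam ^ 2 * γ) (hM : 0 ≤ M) (hK : 0 ≤ K) :
    lam ^ 2 / 18 * (G * Y ^ 2) + lam ^ 2 / 486 * (H * U ^ 2)
      + (2 * (L + F * U) * τ + 2 * L * h * U - T1 - 4 * T3 + 2 * T4 + 2 * h * Q - 2 * U * T6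
        + Ft * U ^ 2 - 2 * T8 * U ^ 2 + W * U * L + W * Q + U * T9) ≤ (L + F * U + τ) ^ 2 := by
  -- Here `L` = div(A∇u), `U` = u, `Y` = |∇u|, `Q` = A∇u·∇u, `τ` is the antisymmetric part, `h` =
  -- div(A∇Ψ) - `hessTrace`, `G` = γm, `H` = γ³R², `H2` = γ²R². The gradient gain 4/18 of `4 * T3`
  -- is shared as 1/18 kept, 1/18 for `C`, 1/9 for `Z1`. The gain 2/324 = 3/486 of `2 * T8` has one
  -- share kept, one for the terms with `E` and one for the terms with `H2`.
  have hG0 : 0 < G := by linarith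
  have hH2 : 0 ≤ H2 := le_trans hG0.le hGH
  have hκ0 : 0 ≤ κ := by rw [hκ]; positivity
  have hκ1 : κ ≤ 4 * N ^ 2 := by
    rw [hκ]; exact mul_le_of_le_one_right (by positivity) hE1
  have hhκ : |2 * h| ≤ κ * G := by
    rw [abs_mul, abs_two, hκ]; linarith
  have hWκ : |W| ≤ κ * G := by
    rw [hW, abs_mul, abs_of_nonneg (by positivity)]
    exact mul_le_of_le_one_right (by positivity) hσ
  have hsum : |2 * h + W| ≤ 2 * (κ * G) := (abs_add_le _ _).trans (by linarith)
  set S := L + F * U with hS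
  -- the square of the symmetric part
  have A : -(16 * N ^ 4 * H2) * U ^ 2 ≤ S ^ 2 - (2 * h + W) * U * S := by
    have h1 : (2 * h + W) ^ 2 ≤ (2 * (κ * G)) ^ 2 := sq_le_sq' (abs_le.1 hsum).1 (abs_le.1 hsum).2
    have h2 : κ ^ 2 ≤ (4 * N ^ 2) ^ 2 := pow_le_pow_left₀ hκ0 hκ1 2
    have h3 : κ ^ 2 * G ^ 2 ≤ (4 * N ^ 2) ^ 2 * H2 := by gcongr
    have h4 : (2 * h + W) ^ 2 * U ^ 2 ≤ (4 * ((4 * N ^ 2) ^ 2 * H2)) * U ^ 2 :=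
      mul_le_mul_of_nonneg_right (by linarith [h1, mul_pow 2 (κ * G) 2, mul_pow κ G 2])
        (sq_nonneg U)
    -- Completing the square: the full (S u)² is spent on h and W, at a cost of order G² ≤ `H2`.
    have h5 : S ^ 2 - (2 * h + W) * U * S
        = (S - (2 * h + W) * U / 2) ^ 2 - (2 * h + W) ^ 2 * U ^ 2 / 4 := by ring
    rw [h5]
    linarith [sq_nonneg (S - (2 * h + W) * U / 2)]
  -- the potential
  have B : -(2 * κ * (4 * Lam * H + H2) + κ * H2) ≤ (2 * h + W) * F := by
    have h1 : |(2 * h + W) * (F + s * R ^ 2)| ≤ 2 * κ * (4 * Lam * H + H2) := by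
      rw [abs_mul]
      calc _ ≤ 2 * (κ * G) * |F + s * R ^ 2| := by gcongr
        _ = 2 * κ * (|F + s * R ^ 2| * G) := by ring
        _ ≤ _ := by gcongr
    have h2 : |2 * h * (s * R ^ 2)| ≤ κ * G * (|s| * R ^ 2) := by
      rw [abs_mul, abs_mul s, abs_of_nonneg (sq_nonneg R)]
      gcongr
    -- The good sign of the multiplier. Its amplitude κG equals the bound for |2h|, so the terms in
    -- |s|R² cancel; smoothing the sign at scale 1/R² costs only κG.
    have h3 : κ * G * (|s| * R ^ 2) - κ * G ≤ -(W * (s * R ^ 2)) := by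
      have h4 : (|s| - 1 / R ^ 2) * (κ * G * R ^ 2) ≤ -(σ * s) * (κ * G * R ^ 2) :=
        mul_le_mul_of_nonneg_right hσs (by positivity)
      have h5 : (|s| - 1 / R ^ 2) * (κ * G * R ^ 2) = κ * G * (|s| * R ^ 2) - κ * G := by
        field_simp
      rw [hW]; linarith
    have h6 : κ * G ≤ κ * H2 := by gcongr
    have e : (2 * h + W) * F = (2 * h + W) * (F + s * R ^ 2) - 2 * h * (s * R ^ 2)
        - W * (s * R ^ 2) := by ring
    rw [e]
    linarith [(abs_le.1 h1).1, (abs_le.1 h2).2]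
  have B' := mul_le_mul_of_nonneg_right B (sq_nonneg U)
  -- the mixed terms
  set kb := 2 * (N ^ 4 * Lam * (4 + 6 * Lam)) + 4 * N ^ 4 * Lam with hkb
  have C : -(lam ^ 2 / 18 * (G * Y ^ 2) + 9 / 2 * (kb ^ 2 / lam ^ 2) * (H2 * U ^ 2))
      ≤ 2 * U * T6 - U * T9 := by
    have h1 : |2 * T6 - T9| ≤ kb * (G * Y) := by
      have : κ * (N ^ 2 * Lam * (G * Y)) ≤ 4 * N ^ 2 * (N ^ 2 * Lam * (G * Y)) := by gcongr
      rw [abs_le] at *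
      rw [hkb]
      constructor <;> linarith [hT6.1, hT6.2, hT9.1, hT9.2]
    have h2 : |U * (2 * T6 - T9)| ≤ |U| * (kb * (G * Y)) := by
      rw [abs_mul]; gcongr
    have h3 : kb * (|U| * Y) ≤ lam ^ 2 / 18 * Y ^ 2 + 9 / 2 * (kb ^ 2 / lam ^ 2) * U ^ 2 := by
      -- Young's inequality, weighted so that the gradient part costs exactly λ²/18.
      have h4 := sq_nonneg (lam * Y / 6 - 3 / 2 * kb * |U| / lam)
      have h5 : (lam * Y / 6 - 3 / 2 * kb * |U| / lam) ^ 2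
          = lam ^ 2 / 36 * Y ^ 2 - kb * (|U| * Y) / 2 + 9 / 4 * (kb ^ 2 / lam ^ 2) * |U| ^ 2 := by
        field_simp; ring
      rw [← sq_abs U]
      linarith
    have h8 : G * (kb * (|U| * Y)) ≤ G * (lam ^ 2 / 18 * Y ^ 2
        + 9 / 2 * (kb ^ 2 / lam ^ 2) * U ^ 2) := mul_le_mul_of_nonneg_left h3 hG0.le
    have h9 : G * (9 / 2 * (kb ^ 2 / lam ^ 2) * U ^ 2) ≤ H2 * (9 / 2 * (kb ^ 2 / lam ^ 2) * U ^ 2) :=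
      mul_le_mul_of_nonneg_right hGH (by positivity)
    have := (abs_le.1 h2).1
    linarith
  have D : |2 * h * Q| ≤ κ * G * (Lam * Y ^ 2) := by
    rw [abs_mul, abs_of_nonneg hQ0]; gcongr
  have D' : |W * Q| ≤ κ * G * (Lam * Y ^ 2) := by
    rw [abs_mul, abs_of_nonneg hQ0]; gcongr
  have E1 : |Ft * U ^ 2| ≤ (4 * N ^ 2 * M + 8 * N ^ 2 * Lam + K) * H2 * U ^ 2 := by
    rw [abs_mul, abs_of_nonneg (sq_nonneg U)]; gcongr
  have E2 := mul_le_mul_of_nonneg_right hT8 (sq_nonneg U)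
  -- collecting the gradient terms
  have Z1 : N ^ 2 * M * Y ^ 2 + E * (12 * N ^ 4 * Lam + 8 * N ^ 2 * Lam) * (G * Y ^ 2)
      ≤ lam ^ 2 / 9 * (G * Y ^ 2) := by
    have hl1 : 18 * (N ^ 2 * M) ≤ lam ^ 2 * γ := by
      have h1 : 0 ≤ N ^ 2 * M := by positivity
      have h2 : 0 ≤ (4 * N ^ 2 * M + 8 * N ^ 2 * Lam + K) + 8 * N ^ 2 * Lam
        + 16 * N ^ 4 + 12 * N ^ 2 + 9 / 2 * (kb ^ 2 / lam ^ 2) := by positivity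
      linarith
    have hl2 : lam ^ 2 * γ ≤ lam ^ 2 * G := by gcongr
    have h3 : N ^ 2 * M * Y ^ 2 ≤ (lam ^ 2 * G / 18) * Y ^ 2 :=
      mul_le_mul_of_nonneg_right (by linarith) (sq_nonneg _)
    have h4 : E * (12 * N ^ 4 * Lam + 8 * N ^ 2 * Lam) ≤ lam ^ 2 / 18 := by
      have h5 : 0 ≤ E * (N ^ 4 * Lam) := by positivity
      have h6 : 0 ≤ E * (N ^ 2 * Lam) := by positivity
      linarith
    have h5 : E * (12 * N ^ 4 * Lam + 8 * N ^ 2 * Lam) * (G * Y ^ 2) ≤ lam ^ 2 / 18 * (G * Y ^ 2) :=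
      mul_le_mul_of_nonneg_right h4 (by positivity)
    linarith
  -- collecting the terms of order zero
  have Z2 : E * (16 * N ^ 4 * Lam + 32 * N ^ 2 * Lam) * (H * U ^ 2)
      + ((4 * N ^ 2 * M + 8 * N ^ 2 * Lam + K) + 8 * N ^ 2 * Lam + 16 * N ^ 4 + 12 * N ^ 2
        + 9 / 2 * (kb ^ 2 / lam ^ 2)) * (H2 * U ^ 2) ≤ lam ^ 2 / 243 * (H * U ^ 2) := by
    have hH0 : 0 ≤ H := by rw [hH]; positivity
    have h1 : E * (16 * N ^ 4 * Lam + 32 * N ^ 2 * Lam) * (H * U ^ 2)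
        ≤ lam ^ 2 / 486 * (H * U ^ 2) :=
      mul_le_mul_of_nonneg_right (by linarith) (by positivity)
    have h2 : ((4 * N ^ 2 * M + 8 * N ^ 2 * Lam + K) + 8 * N ^ 2 * Lam + 16 * N ^ 4 + 12 * N ^ 2
        + 9 / 2 * (kb ^ 2 / lam ^ 2)) * (H2 * U ^ 2) ≤ lam ^ 2 * γ / 486 * (H2 * U ^ 2) := by
      have h3 : 0 ≤ N ^ 2 * M := by positivity
      exact mul_le_mul_of_nonneg_right (by linarith) (by positivity)
    have h4 : lam ^ 2 * γ / 486 * (H2 * U ^ 2) = lam ^ 2 / 486 * (H * U ^ 2) := by rw [hH]; ring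
    linarith
  have Z3 : κ * H2 * U ^ 2 ≤ 4 * N ^ 2 * (H2 * U ^ 2) := by
    have := mul_le_mul_of_nonneg_right hκ1 (show 0 ≤ H2 * U ^ 2 by positivity)
    linarith
  have e1 : L = S - F * U := by rw [hS]; ring
  have e2 : κ * G * (Lam * Y ^ 2) = 4 * N ^ 2 * Lam * E * (G * Y ^ 2) := by rw [hκ]; ring
  have e3 : κ * (4 * Lam * H) * U ^ 2 = 16 * N ^ 2 * Lam * E * (H * U ^ 2) := by rw [hκ]; ring
  rw [e2] at D D'
  have main : (S + τ) ^ 2 - (2 * S * τ + 2 * L * h * U - T1 - 4 * T3 + 2 * T4 + 2 * h * Q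
      - 2 * U * T6 + Ft * U ^ 2 - 2 * T8 * U ^ 2 + W * U * L + W * Q + U * T9)
      = τ ^ 2 + (S ^ 2 - (2 * h + W) * U * S) + (2 * h + W) * F * U ^ 2 + T1 + 4 * T3 - 2 * T4
        - 2 * h * Q + (2 * U * T6 - U * T9) - Ft * U ^ 2 + 2 * (T8 * U ^ 2) - W * Q := by
    rw [e1]; ring
  have := sq_nonneg τ
  linarith [(abs_le.1 hT1).1, (abs_le.1 hT4).2, (abs_le.1 D).2, (abs_le.1 D').2, (abs_le.1 E1).2]

/-! ### The pointwise Carleman inequality. -/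

section Pointwise

variable {X : Type*} [NormedAddCommGroup X] [NormedSpace ℝ X] {n : ℕ}
  {a : Fin n → Fin n → X → ℝ} {e : Fin n → X} {τ : X} {Ψ u W : X → ℝ} {p : X}
  {lam Lam M E γ m r R K s σ : ℝ}

/-- The pointwise Carleman inequality: up to a divergence, the square of the conjugated operator
controls the function and its gradient. -/
theorem CarlemanPoint.pointwise_inequality
    (h : CarlemanPoint a e τ Ψ p lam Lam M E γ m r R K s) (hu : ContDiff ℝ ∞ u)
    (hW : ContDiff ℝ ∞ W) (hWp : W p = 4 * n ^ 2 * E * (γ * m) * σ) (hσ : |σ| ≤ 1)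
    (hσs : |s| - 1 / R ^ 2 ≤ -(σ * s))
    (hdW : ∀ i, |dirDeriv (e i) W p| ≤ 4 * n ^ 2 * E * (γ * m))
    (hsmall : E * smallnessConst n Lam ≤ lam ^ 2)
    (hlarge : lowerOrderConst n lam Lam M K ≤ lam ^ 2 * γ) :
    lam ^ 2 / 18 * (γ * m * ∑ i, frameGrad e u i p ^ 2)
        + lam ^ 2 / 486 * (γ ^ 3 * R ^ 2 * u p ^ 2)
        + (frameDiv e (carlemanSpaceField a e τ Ψ u W) p
          + dirDeriv τ (carlemanTimeField a e τ Ψ u) p) ≤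
      (frameDiv e (flux a (frameGrad e u)) p + conjPotential a e τ Ψ p * u p
        + (dirDeriv τ u p - 2 * (∑ k, flux a (frameGrad e Ψ) k p * frameGrad e u k p)
            - frameDiv e (flux a (frameGrad e Ψ)) p * u p)) ^ 2 := by
  have hγ := h.one_le_γ
  have hm := h.one_le_m
  have hR : 1 ≤ R := hm.trans h.m_le
  have hR0 : 0 < R := by linarith
  set Y := √(∑ i, frameGrad e u i p ^ 2) with hYdef
  have hYsq : ∑ i, frameGrad e u i p ^ 2 = Y ^ 2 :=
    (Real.sq_sqrt (Finset.sum_nonneg fun i _ => sq_nonneg _)).symm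
  have hY : ∀ i, |frameGrad e u i p| ≤ Y := abs_le_sqrt_sum_sq fun i => frameGrad e u i p
  have hG1 : γ * m ≤ γ ^ 2 * R ^ 2 := by
    have : γ * 1 ≤ γ * γ := by gcongr
    have : m * 1 ≤ R * R := by gcongr; exact h.m_le
    calc γ * m ≤ (γ * γ) * (R * R) := by gcongr <;> linarith
      _ = _ := by ring
  have hG2 : (γ * m) ^ 2 ≤ γ ^ 2 * R ^ 2 := by
    rw [mul_pow]; gcongr; exact h.m_le
  have hT3 := h.frame_hessian_term_ge (f := frameGrad e u) hY
  rw [hYsq] at hT3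
  have hQ := h.energy_le (f := frameGrad e u)
  rw [hYsq] at hQ
  have hT1 := abs_bilinear_le h.abs_time hY hY
  have hT9 := abs_sum_fin_le fun i => abs_mul_le_mul (h.abs_flux_le hY i) (hdW i)
  rw [carleman_identity h.diff h.symm h.smooth hu hW, hYsq]
  exact carleman_scalar_inequality (N := (n : ℝ)) (M := M) (K := K) (E := E) (γ := γ) (R := R)
    (κ := 4 * n ^ 2 * E) (s := s) (σ := σ) (H2 := γ ^ 2 * R ^ 2) h.lam_pos h.Lam_pos.le h.E_pos.le
    h.E_le (Nat.cast_nonneg n) hR0 (le_mul_of_one_le_right (by linarith) hm) hγ (by ring) hG1 hG2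
    rfl (hT1.trans (le_of_eq (by ring))) ((le_of_eq (by ring)).trans hT3)
    (h.abs_flux_mul_deriv_form_le hY) h.abs_frameDiv_sub_hessTrace_le h.energy_nonneg hQ
    (Real.sqrt_nonneg _) (h.abs_flux_mul_deriv_hessTrace_le hY) h.abs_time_conjPotential_le
    h.flux_mul_deriv_conjPotential_ge hWp hσ hσs (hT9.trans (le_of_eq (by ring)))
    h.abs_conjPotential_add_le hsmall hlarge h.M_pos.le h.K_nonneg

end Pointwise

/-! ### Derivatives of the Carleman weight. -/

section Weight

variable {n : ℕ}

/-- Space-time. -/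
abbrev SpaceTime (n : ℕ) : Type := EuclideanSpace ℝ (Fin n) × ℝ

/-- The spatial coordinate directions in space-time. -/
noncomputable def spaceDir (n : ℕ) (i : Fin n) : SpaceTime n := (EuclideanSpace.single i 1, 0)

/-- The time direction in space-time. -/
def timeDir (n : ℕ) : SpaceTime n := (0, 1)

theorem isOpen_fst_ne_zero : IsOpen {p : SpaceTime n | p.1 ≠ 0} :=
  isOpen_ne_fun continuous_fst continuous_const

theorem contDiffAt_norm_fst_rpow {p : SpaceTime n} (hp : p.1 ≠ 0) (s : ℝ) :
    ContDiffAt ℝ ∞ (fun q : SpaceTime n => ‖q.1‖ ^ s) p := by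
  have h : ContDiffAt ℝ ∞ (fun q : SpaceTime n => ‖q.1‖) p := contDiffAt_fst.norm ℝ hp
  exact h.rpow_const_of_ne (norm_ne_zero_iff.2 hp)

theorem dirDeriv_norm_fst_rpow {p : SpaceTime n} (hp : p.1 ≠ 0) (s : ℝ) (v : SpaceTime n) :
    dirDeriv v (fun q : SpaceTime n => ‖q.1‖ ^ s) p
      = s * ‖p.1‖ ^ (s - 2) * inner ℝ p.1 v.1 := by
  have h0 : 0 < ‖p.1‖ := norm_pos_iff.2 hp
  have e : (fun q : SpaceTime n => ‖q.1‖ ^ s) = fun q => (‖q.1‖ ^ 2) ^ (s / 2) := by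
    funext q
    rw [← Real.rpow_natCast, ← Real.rpow_mul (norm_nonneg _)]
    congr 1; push_cast; ring
  have h1 : HasFDerivAt (fun q : SpaceTime n => ‖q.1‖ ^ 2) _ p :=
    (hasFDerivAt_fst (𝕜 := ℝ) (p := p)).norm_sq
  have h2 := h1.rpow_const (p := s / 2) (Or.inl (by positivity))
  rw [e, h2.dirDeriv_eq]
  have e2 : (‖p.1‖ ^ 2) ^ (s / 2 - 1) = ‖p.1‖ ^ (s - 2) := by
    rw [← Real.rpow_natCast, ← Real.rpow_mul (norm_nonneg _)]
    congr 1; push_cast; ring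
  simp [e2]
  ring

theorem spaceDir_fst_apply (i k : Fin n) :
    (spaceDir n i).1 k = if k = i then (1 : ℝ) else 0 := by
  simp [spaceDir]

theorem spaceDir_snd (i : Fin n) : (spaceDir n i).2 = 0 := rfl

theorem inner_spaceDir (x : EuclideanSpace ℝ (Fin n)) (i : Fin n) :
    inner ℝ x (spaceDir n i).1 = x i := by
  simp [spaceDir, EuclideanSpace.inner_single_right]

/-- The radial functions `R^(2/3) |x|^s`. -/
noncomputable def radial (n : ℕ) (R s : ℝ) (p : SpaceTime n) : ℝ :=
  R ^ (2 / 3 : ℝ) * ‖p.1‖ ^ s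

theorem contDiffAt_radial {p : SpaceTime n} (hp : p.1 ≠ 0) (R s : ℝ) :
    ContDiffAt ℝ ∞ (radial n R s) p :=
  contDiffAt_const.mul (contDiffAt_norm_fst_rpow hp s)

theorem dirDeriv_radial {p : SpaceTime n} (hp : p.1 ≠ 0) (R s : ℝ) (v : SpaceTime n) :
    dirDeriv v (radial n R s) p = s * radial n R (s - 2) p * inner ℝ p.1 v.1 := by
  have := dirDeriv_const_mul (v := v) (R ^ (2 / 3 : ℝ))
    ((contDiffAt_norm_fst_rpow hp s).differentiableAt (by simp))
  change dirDeriv v (fun q => R ^ (2 / 3 : ℝ) * ‖q.1‖ ^ s) p = _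
  rw [this, dirDeriv_norm_fst_rpow hp, radial]
  ring

theorem dirDeriv_coord (v p : SpaceTime n) (k : Fin n) :
    dirDeriv v (fun q : SpaceTime n => q.1 k) p = v.1 k := by
  have h : HasFDerivAt (fun q : SpaceTime n => q.1 k)
      ((EuclideanSpace.proj k).comp (ContinuousLinearMap.fst ℝ _ ℝ)) p :=
    ((EuclideanSpace.proj (𝕜 := ℝ) k).comp
      (ContinuousLinearMap.fst ℝ (EuclideanSpace ℝ (Fin n)) ℝ)).hasFDerivAt
  rw [h.dirDeriv_eq]; rfl

theorem contDiff_coord (k : Fin n) : ContDiff ℝ ∞ (fun q : SpaceTime n => q.1 k) :=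
  ((EuclideanSpace.proj (𝕜 := ℝ) k).comp
      (ContinuousLinearMap.fst ℝ (EuclideanSpace ℝ (Fin n)) ℝ)).contDiff

theorem dirDeriv_comp_snd {f : ℝ → ℝ} {p : SpaceTime n} (hf : DifferentiableAt ℝ f p.2)
    (v : SpaceTime n) : dirDeriv v (fun q : SpaceTime n => f q.2) p = deriv f p.2 * v.2 := by
  have h := hf.hasDerivAt.comp_hasFDerivAt p (hasFDerivAt_snd (𝕜 := ℝ) (p := p))
  have h' : HasFDerivAt (fun q : SpaceTime n => f q.2) _ p := h
  rw [h'.dirDeriv_eq]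
  simp

theorem carlemanWeight_eq (γ R : ℝ) (ψ : ℝ → ℝ) :
    (carlemanWeight γ R ψ : SpaceTime n → ℝ) =
      fun p => γ * (1 - p.2) * radial n R (4 / 3) p + ψ p.2 * R ^ 2 := by
  funext p; simp only [carlemanWeight, radial]; ring

variable {γ R : ℝ} {ψ : ℝ → ℝ} {p : SpaceTime n}

theorem contDiffAt_carlemanWeight (hψ : ContDiff ℝ ∞ ψ) (hp : p.1 ≠ 0) :
    ContDiffAt ℝ ∞ (carlemanWeight γ R ψ : SpaceTime n → ℝ) p := by
  rw [carlemanWeight_eq]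
  have h1 : ContDiffAt ℝ ∞ (fun q : SpaceTime n => γ * (1 - q.2)) p :=
    contDiffAt_const.mul (contDiffAt_const.sub contDiffAt_snd)
  have h2 : ContDiffAt ℝ ∞ (fun q : SpaceTime n => ψ q.2 * R ^ 2) p :=
    (hψ.contDiffAt.comp p contDiffAt_snd).mul contDiffAt_const
  exact (h1.mul (contDiffAt_radial hp R _)).add h2

/-- The affine factor `γ (1 - t)`. -/
theorem dirDeriv_timeFactor (γ : ℝ) (p v : SpaceTime n) :
    dirDeriv v (fun q : SpaceTime n => γ * (1 - q.2)) p = -γ * v.2 := by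
  have h := dirDeriv_comp_snd (p := p) (f := fun t => γ * (1 - t)) (by fun_prop) v
  rw [h]
  have : HasDerivAt (fun t : ℝ => γ * (1 - t)) (γ * (-1)) p.2 :=
    ((hasDerivAt_id p.2).const_sub 1).const_mul γ
  rw [this.deriv]; ring

theorem differentiableAt_timeFactor (γ : ℝ) (p : SpaceTime n) :
    DifferentiableAt ℝ (fun q : SpaceTime n => γ * (1 - q.2)) p := by fun_prop

theorem dirDeriv_carlemanWeight (hψ : ContDiff ℝ ∞ ψ) (hp : p.1 ≠ 0) (v : SpaceTime n) :
    dirDeriv v (carlemanWeight γ R ψ) p =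
      γ * (1 - p.2) * (4 / 3 * radial n R (-2 / 3) p * inner ℝ p.1 v.1)
        - γ * v.2 * radial n R (4 / 3) p + deriv ψ p.2 * v.2 * R ^ 2 := by
  have hψd : DifferentiableAt ℝ ψ p.2 := hψ.differentiable (by simp) _
  have h1 := differentiableAt_timeFactor γ p
  have h2 := (contDiffAt_radial hp R (4 / 3)).differentiableAt (by simp)
  have h3 : DifferentiableAt ℝ (fun q : SpaceTime n => ψ q.2) p :=
    hψd.comp p differentiableAt_snd
  have h4 : DifferentiableAt ℝ (fun q : SpaceTime n => ψ q.2 * R ^ 2) p := h3.mul_const _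
  rw [carlemanWeight_eq, dirDeriv_add (h1.fun_mul h2) h4, dirDeriv_mul h1 h2,
    dirDeriv_timeFactor, dirDeriv_radial hp, dirDeriv_mul h3 (differentiableAt_const _),
    dirDeriv_const, dirDeriv_comp_snd hψd, show (4 / 3 - 2 : ℝ) = -2 / 3 by norm_num]
  ring

theorem dirDeriv_space_carlemanWeight (hψ : ContDiff ℝ ∞ ψ) (hp : p.1 ≠ 0) (k : Fin n) :
    dirDeriv (spaceDir n k) (carlemanWeight γ R ψ) p =
      4 / 3 * (γ * (1 - p.2)) * (radial n R (-2 / 3) p * p.1 k) := by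
  rw [dirDeriv_carlemanWeight hψ hp, inner_spaceDir]
  simp [spaceDir]; ring

theorem dirDeriv_time_carlemanWeight (hψ : ContDiff ℝ ∞ ψ) (hp : p.1 ≠ 0) :
    dirDeriv (timeDir n) (carlemanWeight γ R ψ) p =
      deriv ψ p.2 * R ^ 2 - γ * radial n R (4 / 3) p := by
  rw [dirDeriv_carlemanWeight hψ hp]
  simp [timeDir]; ring

theorem dirDeriv_dirDeriv_space_carlemanWeight (hψ : ContDiff ℝ ∞ ψ) (hp : p.1 ≠ 0)
    (v : SpaceTime n) (k : Fin n) :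
    dirDeriv v (dirDeriv (spaceDir n k) (carlemanWeight γ R ψ)) p =
      4 / 3 * (γ * (1 - p.2)) * (radial n R (-2 / 3) p * v.1 k
        - 2 / 3 * radial n R (-8 / 3) p * inner ℝ p.1 v.1 * p.1 k)
        - 4 / 3 * γ * v.2 * (radial n R (-2 / 3) p * p.1 k) := by
  have he : dirDeriv (spaceDir n k) (carlemanWeight γ R ψ) =ᶠ[nhds p]
      fun q => (4 / 3 * (γ * (1 - q.2))) * (radial n R (-2 / 3) q * q.1 k) := by
    filter_upwards [isOpen_fst_ne_zero.mem_nhds hp] with q hq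
    exact dirDeriv_space_carlemanWeight hψ hq k
  have h1 := differentiableAt_timeFactor γ p
  have h2 := (contDiffAt_radial hp R (-2 / 3)).differentiableAt (by simp)
  have h3 := (contDiff_coord (n := n) k).differentiable (by simp) p
  rw [he.dirDeriv_eq, dirDeriv_mul (h1.const_mul _) (h2.fun_mul h3), dirDeriv_const_mul _ h1,
    dirDeriv_timeFactor, dirDeriv_mul h2 h3, dirDeriv_coord, dirDeriv_radial hp,
    show (-2 / 3 - 2 : ℝ) = -8 / 3 by norm_num]
  ring

theorem hessian_carlemanWeight (hψ : ContDiff ℝ ∞ ψ) (hp : p.1 ≠ 0) (i k : Fin n) :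
    dirDeriv (spaceDir n i) (dirDeriv (spaceDir n k) (carlemanWeight γ R ψ)) p =
      4 / 3 * (γ * (1 - p.2)) * (radial n R (-2 / 3) p * (if k = i then 1 else 0)
        - 2 / 3 * (radial n R (-8 / 3) p * (p.1 i * p.1 k))) := by
  rw [dirDeriv_dirDeriv_space_carlemanWeight hψ hp, inner_spaceDir]
  rw [spaceDir_fst_apply, spaceDir_snd]
  ring

theorem mixed_carlemanWeight (hψ : ContDiff ℝ ∞ ψ) (hp : p.1 ≠ 0) (k : Fin n) :
    dirDeriv (timeDir n) (dirDeriv (spaceDir n k) (carlemanWeight γ R ψ)) p =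
      -(4 / 3 * γ * (radial n R (-2 / 3) p * p.1 k)) := by
  rw [dirDeriv_dirDeriv_space_carlemanWeight hψ hp]
  simp [timeDir]

theorem time_time_carlemanWeight (hψ : ContDiff ℝ ∞ ψ) (hp : p.1 ≠ 0) :
    dirDeriv (timeDir n) (dirDeriv (timeDir n) (carlemanWeight γ R ψ)) p =
      deriv (deriv ψ) p.2 * R ^ 2 := by
  have he : dirDeriv (timeDir n) (carlemanWeight γ R ψ) =ᶠ[nhds p]
      fun q : SpaceTime n => deriv ψ q.2 * R ^ 2 - γ * radial n R (4 / 3) q := by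
    filter_upwards [isOpen_fst_ne_zero.mem_nhds hp] with q hq
    exact dirDeriv_time_carlemanWeight hψ hq
  have hψd : DifferentiableAt ℝ (deriv ψ) p.2 := by
    have : ContDiff ℝ ∞ (deriv ψ) := (contDiff_infty_iff_deriv.1 hψ).2
    exact this.differentiable (by simp) _
  have h2 := (contDiffAt_radial hp R (4 / 3)).differentiableAt (by simp)
  have h3 : DifferentiableAt ℝ (fun q : SpaceTime n => deriv ψ q.2) p :=
    hψd.comp p differentiableAt_snd
  rw [he.dirDeriv_eq, dirDeriv_sub (h3.mul_const _) (h2.const_mul _), dirDeriv_const_mul _ h2,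
    dirDeriv_radial hp, dirDeriv_mul h3 (differentiableAt_const _),
    dirDeriv_const, dirDeriv_comp_snd hψd]
  simp [timeDir]; ring

theorem third_carlemanWeight (hψ : ContDiff ℝ ∞ ψ) (hp : p.1 ≠ 0) (j i k : Fin n) :
    dirDeriv (spaceDir n j)
      (dirDeriv (spaceDir n i) (dirDeriv (spaceDir n k) (carlemanWeight γ R ψ))) p =
      4 / 3 * (γ * (1 - p.2)) * (-(2 / 3) * (radial n R (-8 / 3) p * p.1 j)
          * (if k = i then 1 else 0)
        - 2 / 3 * (-(8 / 3) * (radial n R (-14 / 3) p * (p.1 i * p.1 j * p.1 k))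
          + radial n R (-8 / 3) p * (p.1 k * (if i = j then 1 else 0)
            + p.1 i * (if k = j then 1 else 0)))) := by
  have he : dirDeriv (spaceDir n i) (dirDeriv (spaceDir n k) (carlemanWeight γ R ψ)) =ᶠ[nhds p]
      fun q => (4 / 3 * (γ * (1 - q.2))) * (radial n R (-2 / 3) q * (if k = i then 1 else 0)
        - 2 / 3 * (radial n R (-8 / 3) q * (q.1 i * q.1 k))) := by
    filter_upwards [isOpen_fst_ne_zero.mem_nhds hp] with q hq
    exact hessian_carlemanWeight hψ hq i k
  have h1 := differentiableAt_timeFactor γ p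
  have h2 := (contDiffAt_radial hp R (-2 / 3)).differentiableAt (by simp)
  have h3 := (contDiffAt_radial hp R (-8 / 3)).differentiableAt (by simp)
  have hi := (contDiff_coord (n := n) i).differentiable (by simp) p
  have hk := (contDiff_coord (n := n) k).differentiable (by simp) p
  have h5 := h3.fun_mul (hi.fun_mul hk)
  have h6 := h5.const_mul (2 / 3)
  have h7 := h2.mul_const (if k = i then (1 : ℝ) else 0)
  rw [he.dirDeriv_eq, dirDeriv_mul (h1.const_mul _) (h7.fun_sub h6), dirDeriv_const_mul _ h1,
    dirDeriv_timeFactor, dirDeriv_sub h7 h6, dirDeriv_mul h2 (differentiableAt_const _),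
    dirDeriv_const, dirDeriv_const_mul _ h5, dirDeriv_mul h3 (hi.fun_mul hk), dirDeriv_mul hi hk,
    dirDeriv_coord, dirDeriv_coord, dirDeriv_radial hp, dirDeriv_radial hp, inner_spaceDir,
    show (-2 / 3 - 2 : ℝ) = -8 / 3 by norm_num, show (-8 / 3 - 2 : ℝ) = -14 / 3 by norm_num]
  rw [spaceDir_fst_apply, spaceDir_fst_apply, spaceDir_snd]
  ring

end Weight

/-! ### Bounds for the weight and construction of the multiplier. -/

section WeightBounds

variable {n : ℕ} {γ R : ℝ} {ψ : ℝ → ℝ} {p : SpaceTime n}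

theorem radial_add (hp : p.1 ≠ 0) (R s : ℝ) (k : ℕ) :
    radial n R (s + k) p = radial n R s p * ‖p.1‖ ^ k := by
  rw [radial, radial, Real.rpow_add (norm_pos_iff.2 hp), Real.rpow_natCast]; ring

theorem radial_pos (hp : p.1 ≠ 0) (hR : 0 < R) (s : ℝ) : 0 < radial n R s p :=
  mul_pos (Real.rpow_pos_of_pos hR _) (Real.rpow_pos_of_pos (norm_pos_iff.2 hp) _)

/-- The homogeneity relation behind the exponents 2/3 and 4/3: it turns (γm)(γmr)² into γ³R², with
no dependence on |x|. -/
theorem radial_pow_three_mul (hp : p.1 ≠ 0) (hR : 0 < R) :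
    radial n R (-2 / 3) p ^ 3 * ‖p.1‖ ^ 2 = R ^ 2 := by
  have h0 : 0 < ‖p.1‖ := norm_pos_iff.2 hp
  rw [radial, mul_pow, ← Real.rpow_natCast (R ^ _), ← Real.rpow_natCast (‖p.1‖ ^ _),
    ← Real.rpow_mul hR.le, ← Real.rpow_mul h0.le, ← Real.rpow_natCast ‖p.1‖, mul_assoc,
    ← Real.rpow_add h0]
  norm_num

theorem abs_apply_le_norm (x : EuclideanSpace ℝ (Fin n)) (i : Fin n) : |x i| ≤ ‖x‖ :=
  PiLp.norm_apply_le x i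

theorem sum_sq_eq_norm_sq (x : EuclideanSpace ℝ (Fin n)) : ∑ i, x i ^ 2 = ‖x‖ ^ 2 :=
  (EuclideanSpace.real_norm_sq_eq x).symm

theorem abs_ite_le_one (P : Prop) [Decidable P] : |(if P then (1 : ℝ) else 0)| ≤ 1 := by
  split_ifs <;> simp

/-- The Hessian of the power `|x|^(4/3)` is positive definite. -/
theorem radial_hessian_form_ge {x : EuclideanSpace ℝ (Fin n)} {c m m' r : ℝ} (hc : 0 ≤ c)
    (hm : 0 ≤ m') (hr : ‖x‖ = r) (hm' : m' * r ^ 2 = m) (q : Fin n → ℝ) :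
    c * (m / 3) * ∑ i, q i ^ 2 ≤ ∑ i, ∑ j, c * (m * (if j = i then 1 else 0)
      - 2 / 3 * (m' * (x i * x j))) * q i * q j := by
  have e : ∑ i, ∑ j, c * (m * (if j = i then 1 else 0)
      - 2 / 3 * (m' * (x i * x j))) * q i * q j
      = c * (m * ∑ i, q i ^ 2) - c * (2 / 3 * (m' * (∑ i, x i * q i) ^ 2)) := by
    have e1 : (∑ i, x i * q i) ^ 2 = ∑ i, ∑ j, (x i * q i) * (x j * q j) := by
      rw [sq, Finset.sum_mul_sum]
    have e2 : ∑ i, q i ^ 2 = ∑ i, ∑ j, (if j = i then 1 else 0) * q i * q j := by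
      refine Finset.sum_congr rfl fun i _ => ?_
      simp [sq]
    rw [e1, e2]
    simp only [Finset.mul_sum, ← Finset.sum_sub_distrib]
    refine Finset.sum_congr rfl fun i _ => Finset.sum_congr rfl fun j _ => ?_
    ring
  -- The worst direction is the radial one, with eigenvalue factor 1 - 2/3 = 1/3.
  have hcs := Finset.sum_mul_sq_le_sq_mul_sq Finset.univ (fun i => x i) q
  rw [sum_sq_eq_norm_sq, hr] at hcs
  have h1 : m' * (∑ i, x i * q i) ^ 2 ≤ m * ∑ i, q i ^ 2 := by
    rw [← hm', mul_assoc]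
    exact mul_le_mul_of_nonneg_left hcs hm
  rw [e]
  have h2 := mul_le_mul_of_nonneg_left h1 hc
  linarith

/-- All weight bounds follow from ∇Ψ = (4/3)γ(1 - t)m x with 1/8 ≤ 1 - t ≤ 1; the time restriction
of the cylinder is what keeps the convexity uniform. Also r < R gives m ≥ 1, and (mr)³ = R²r ≤ R³
gives mr ≤ R. -/
theorem carlemanPoint_of_mem {a : Fin n → Fin n → SpaceTime n → ℝ} {Ψ : SpaceTime n → ℝ}
    {lam Lam M E K : ℝ} (hp : p ∈ carlemanCylinder n R) (hγ : 1 ≤ γ)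
    (hψ : ContDiff ℝ ∞ ψ) (hK : ∀ t ∈ Icc (0 : ℝ) 1, |deriv (deriv ψ) t| ≤ K)
    (hΨ : ContDiff ℝ ∞ Ψ) (hΨp : Ψ =ᶠ[nhds p] carlemanWeight γ R ψ)
    (diff : ∀ i j, DifferentiableAt ℝ (a i j) p)
    (symm : ∀ i j, a i j p = a j i p)
    (coercive : ∀ ξ : Fin n → ℝ, lam * ∑ i, ξ i ^ 2 ≤ ∑ i, ∑ j, a i j p * ξ i * ξ j)
    (upper : ∀ ξ : Fin n → ℝ, ∑ i, ∑ j, a i j p * ξ i * ξ j ≤ Lam * ∑ i, ξ i ^ 2)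
    (abs_coeff : ∀ i j, |a i j p| ≤ Lam)
    (abs_deriv : ∀ k i j, |dirDeriv (spaceDir n k) (a i j) p| ≤ E / ‖p.1‖)
    (abs_time : ∀ i j, |dirDeriv (timeDir n) (a i j) p| ≤ M)
    (lam_pos : 0 < lam) (lam_le : lam ≤ Lam) (E_pos : 0 < E) (E_le : E ≤ 1) (M_pos : 0 < M) :
    CarlemanPoint a (spaceDir n) (timeDir n) Ψ p lam Lam M E γ (radial n R (-2 / 3) p) ‖p.1‖ R K
      (deriv ψ p.2) := by
  obtain ⟨hr1, hrR, ht⟩ := hp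
  have hp0 : p.1 ≠ 0 := norm_pos_iff.1 (by linarith)
  set r := ‖p.1‖ with hr
  have hr0 : 0 < r := by linarith
  have hR : 0 < R := by linarith
  set m := radial n R (-2 / 3) p with hm
  have hm0 : 0 < m := radial_pos hp0 hR _
  have hm2 : radial n R (-8 / 3) p * r ^ 2 = m := by
    rw [hm, hr, ← radial_add hp0]; congr 1; norm_num
  have hm3 : radial n R (-14 / 3) p * r ^ 4 = m := by
    rw [hm, hr, ← radial_add hp0]; congr 1; norm_num
  have hm4 : radial n R (4 / 3) p = m * r ^ 2 := by
    rw [hm, hr, ← radial_add hp0]; congr 1; norm_num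
  have hm2' : radial n R (-8 / 3) p = m / r ^ 2 := by rw [← hm2]; field_simp
  have hm3' : radial n R (-14 / 3) p = m / r ^ 4 := by rw [← hm3]; field_simp
  have hrad : m ^ 3 * r ^ 2 = R ^ 2 := radial_pow_three_mul hp0 hR
  have hmr : m * r ≤ R := by
    refine le_of_pow_le_pow_left₀ (n := 3) (by norm_num) hR.le ?_
    calc (m * r) ^ 3 = R ^ 2 * r := by rw [← hrad]; ring
      _ ≤ R ^ 2 * R := by gcongr
      _ = R ^ 3 := by ring
  have hm1 : 1 ≤ m := by
    by_contra hlt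
    push Not at hlt
    have h1 : m ^ 3 < 1 := pow_lt_one₀ hm0.le hlt (by norm_num)
    have h2 : m ^ 3 * r ^ 2 < 1 * r ^ 2 := mul_lt_mul_of_pos_right h1 (by positivity)
    have h3 : r ^ 2 ≤ R ^ 2 := by gcongr
    linarith
  have hmR : m ≤ R := le_trans (le_mul_of_one_le_right hm0.le hr1.le) hmr
  have hθ0 : 1 / 8 ≤ 1 - p.2 := by linarith [ht.2]
  have hθ1 : 1 - p.2 ≤ 1 := by linarith [ht.1]
  have hx : ∀ k, |p.1 k| ≤ r := abs_apply_le_norm p.1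
  have hc : |4 / 3 * (γ * (1 - p.2))| ≤ 4 / 3 * γ := by
    rw [abs_of_nonneg (by have : 0 ≤ γ * (1 - p.2) := mul_nonneg (by linarith) (by linarith)
                          linarith)]
    have : γ * (1 - p.2) ≤ γ * 1 := by gcongr
    linarith
  have eΨ : ∀ v, dirDeriv v Ψ p = dirDeriv v (carlemanWeight γ R ψ) p := fun v => hΨp.dirDeriv_eq
  have eΨ2 : ∀ v w, dirDeriv v (dirDeriv w Ψ) p = dirDeriv v (dirDeriv w (carlemanWeight γ R ψ)) p :=
    fun v w => hΨp.dirDeriv.dirDeriv_eq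
  have hgrad : ∀ k, frameGrad (spaceDir n) Ψ k p = 4 / 3 * (γ * (1 - p.2)) * (m * p.1 k) := fun k =>
    (eΨ _).trans (dirDeriv_space_carlemanWeight hψ hp0 k)
  have hsum : ∑ k, frameGrad (spaceDir n) Ψ k p ^ 2
      = 16 / 9 * (γ ^ 2 * m ^ 2 * r ^ 2) * (1 - p.2) ^ 2 := by
    simp only [hgrad, mul_pow]
    rw [← Finset.mul_sum, ← Finset.mul_sum, sum_sq_eq_norm_sq]
    ring
  have hγm : 0 ≤ γ * m := by positivity
  refine
    { diff := diff, symm := symm, coercive := coercive, upper := upper, abs_coeff := abs_coeff,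
      abs_deriv := abs_deriv, abs_time := abs_time, smooth := hΨ, one_le_m := hm1,
      one_le_r := hr1.le, one_le_γ := hγ, radius := hrad, m_le := hmR, mr_le := hmr,
      lam_pos := lam_pos, lam_le := lam_le, E_pos := E_pos, E_le := E_le, M_pos := M_pos,
      K_nonneg := (abs_nonneg _).trans (hK 0 (by simp)), abs_grad := ?_, grad_lower := ?_,
      grad_upper := ?_, convex := ?_, abs_hess := ?_, abs_third := ?_, abs_mixed := ?_, time := ?_,
      abs_time_time := ?_ }
  · intro k
    rw [hgrad]
    have h1 : |m * p.1 k| ≤ m * r := abs_mul_le_mul (abs_of_pos hm0).le (hx k)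
    refine (abs_mul_le_mul hc h1).trans ?_
    have : 0 ≤ γ * m * r := by positivity
    linarith
  · rw [hsum]
    -- The constant is (16/9)(1/8)² = 1/36.
    have h1 : (1 / 8 : ℝ) ^ 2 ≤ (1 - p.2) ^ 2 := by gcongr
    have h2 : 0 ≤ γ ^ 2 * m ^ 2 * r ^ 2 := by positivity
    have := mul_le_mul_of_nonneg_left h1 h2
    linarith
  · rw [hsum]
    have h1 : (1 - p.2) ^ 2 ≤ 1 := pow_le_one₀ (by linarith) hθ1
    have h2 : 0 ≤ γ ^ 2 * m ^ 2 * r ^ 2 := by positivity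
    have := mul_le_mul_of_nonneg_left h1 h2
    linarith
  · intro q
    simp only [eΨ2, hessian_carlemanWeight hψ hp0]
    have h0 : 0 ≤ γ * (1 - p.2) := mul_nonneg (by linarith) (by linarith)
    refine le_trans ?_ (radial_hessian_form_ge (by positivity) (radial_pos hp0 hR _).le hr.symm
      hm2 q)
    refine mul_le_mul_of_nonneg_right ?_ (Finset.sum_nonneg fun i _ => sq_nonneg _)
    -- The constant is (4/3)(1/8)(1/3) = 1/18.
    have h1 : γ * m * (1 / 8) ≤ γ * m * (1 - p.2) := by gcongr
    linarith
  · intro i k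
    rw [eΨ2, hessian_carlemanWeight hψ hp0, hm2']
    have h1 : |m * (if k = i then (1 : ℝ) else 0)| ≤ m * 1 :=
      abs_mul_le_mul (abs_of_pos hm0).le (abs_ite_le_one _)
    have h2 : |m / r ^ 2 * (p.1 i * p.1 k)| ≤ m / r ^ 2 * (r * r) :=
      abs_mul_le_mul (abs_of_nonneg (by positivity)).le (abs_mul_le_mul (hx i) (hx k))
    have h2' : m / r ^ 2 * (r * r) = m := by field_simp
    rw [h2'] at h2
    have h3 : |m * (if k = i then (1 : ℝ) else 0) - 2 / 3 * (m / r ^ 2 * (p.1 i * p.1 k))|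
        ≤ 5 / 3 * m := by
      rw [abs_le] at *; constructor <;> linarith [h1.1, h1.2, h2.1, h2.2]
    refine (abs_mul_le_mul hc h3).trans ?_
    linarith
  · intro j i k
    have e3 : dirDeriv (spaceDir n j) (dirDeriv (spaceDir n i) (dirDeriv (spaceDir n k) Ψ)) p
        = dirDeriv (spaceDir n j)
          (dirDeriv (spaceDir n i) (dirDeriv (spaceDir n k) (carlemanWeight γ R ψ))) p :=
      hΨp.dirDeriv.dirDeriv.dirDeriv_eq
    rw [e3, third_carlemanWeight hψ hp0, hm2', hm3']
    have hmle : m / r ≤ m := div_le_self hm0.le hr1.le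
    have b1 : ∀ l, |m / r ^ 2 * p.1 l| ≤ m := fun l => by
      refine (abs_mul_le_mul (abs_of_nonneg (by positivity)).le (hx l)).trans
        (le_trans (le_of_eq ?_) hmle)
      field_simp
    have h1 : |m / r ^ 2 * p.1 j * (if k = i then (1 : ℝ) else 0)| ≤ m * 1 :=
      abs_mul_le_mul (b1 j) (abs_ite_le_one _)
    have h2 : |m / r ^ 4 * (p.1 i * p.1 j * p.1 k)| ≤ m := by
      refine (abs_mul_le_mul (abs_of_nonneg (by positivity)).le
        (abs_mul_le_mul (abs_mul_le_mul (hx i) (hx j)) (hx k))).trans (le_trans (le_of_eq ?_) hmle)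
      field_simp
    have h3 : |m / r ^ 2 * p.1 k * (if i = j then (1 : ℝ) else 0)| ≤ m * 1 :=
      abs_mul_le_mul (b1 k) (abs_ite_le_one _)
    have h4 : |m / r ^ 2 * p.1 i * (if k = j then (1 : ℝ) else 0)| ≤ m * 1 :=
      abs_mul_le_mul (b1 i) (abs_ite_le_one _)
    -- 34/9 = 2/3 + (2/3)(8/3 + 2), adding the four terms, each bounded through m/r ≤ m.
    refine (abs_mul_le_mul (D := 34 / 9 * m) hc ?_).trans (by linarith)
    rw [mul_add (m / r ^ 2), ← mul_assoc (m / r ^ 2), ← mul_assoc (m / r ^ 2), mul_assoc (-(2 / 3))]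
    rw [abs_le] at *
    constructor <;> linarith [h1.1, h1.2, h2.1, h2.2, h3.1, h3.2, h4.1, h4.2]
  · intro k
    rw [eΨ2, mixed_carlemanWeight hψ hp0, abs_neg]
    have h1 : |m * p.1 k| ≤ m * r := abs_mul_le_mul (abs_of_pos hm0).le (hx k)
    refine (abs_mul_le_mul (abs_of_nonneg (by positivity)).le h1).trans ?_
    have : 0 ≤ γ * m * r := by positivity
    linarith
  · rw [eΨ, dirDeriv_time_carlemanWeight hψ hp0, hm4, sub_sub_cancel_left, abs_neg,
      abs_of_nonneg (by positivity)]
    linarith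
  · rw [eΨ2, time_time_carlemanWeight hψ hp0, abs_mul, abs_of_nonneg (sq_nonneg R)]
    exact mul_le_mul_of_nonneg_right (hK _ ⟨by linarith [ht.1], by linarith⟩) (sq_nonneg _)

/-- A smooth approximation of minus the sign of `ψ'`. -/
noncomputable def smoothSign (ψ : ℝ → ℝ) (ε t : ℝ) : ℝ :=
  -(deriv ψ t / √(deriv ψ t ^ 2 + ε ^ 2))

theorem contDiff_smoothSign (hψ : ContDiff ℝ ∞ ψ) {ε : ℝ} (hε : 0 < ε) :
    ContDiff ℝ ∞ (smoothSign ψ ε) := by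
  have h : ContDiff ℝ ∞ (deriv ψ) := (contDiff_infty_iff_deriv.1 hψ).2
  have hpos : ∀ t, deriv ψ t ^ 2 + ε ^ 2 ≠ 0 := fun t => by positivity
  have h1 : ContDiff ℝ ∞ (fun t => deriv ψ t ^ 2 + ε ^ 2) := (h.pow 2).add contDiff_const
  exact (h.div (h1.sqrt hpos) fun t => (Real.sqrt_pos.2 (by positivity)).ne').neg

theorem abs_smoothSign_le (ε t : ℝ) : |smoothSign ψ ε t| ≤ 1 := by
  rw [smoothSign, abs_neg, abs_div, abs_of_nonneg (Real.sqrt_nonneg _)]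
  refine div_le_one_of_le₀ (Real.abs_le_sqrt ?_) (Real.sqrt_nonneg _)
  have := sq_nonneg ε
  linarith

/-- With s = ψ', this is s²/√(s² + ε²) ≥ |s| - ε, from √(s² + ε²) ≤ |s| + ε. A smooth substitute for
the sign is needed because W must be differentiable; the choice ε = 1/R² makes the error εR²
bounded. -/
theorem abs_deriv_sub_le_smoothSign {ε : ℝ} (hε : 0 < ε) (t : ℝ) :
    |deriv ψ t| - ε ≤ -(smoothSign ψ ε t * deriv ψ t) := by
  set s := deriv ψ t with hs
  have hpos : 0 < √(s ^ 2 + ε ^ 2) := Real.sqrt_pos.2 (by positivity)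
  have e : -(smoothSign ψ ε t * s) = s ^ 2 / √(s ^ 2 + ε ^ 2) := by
    rw [smoothSign, ← hs]; ring
  rw [e, le_div_iff₀ hpos]
  have hle : √(s ^ 2 + ε ^ 2) ≤ |s| + ε := by
    refine Real.sqrt_le_iff.2 ⟨by positivity, ?_⟩
    have : 0 ≤ |s| * ε := by positivity
    nlinarith [sq_abs s]
  rcases le_total |s| ε with h | h
  · exact (mul_nonpos_of_nonpos_of_nonneg (by linarith) hpos.le).trans (sq_nonneg s)
  · calc (|s| - ε) * √(s ^ 2 + ε ^ 2) ≤ (|s| - ε) * (|s| + ε) := by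
          gcongr
      _ = s ^ 2 - ε ^ 2 := by rw [← sq_abs s]; ring
      _ ≤ s ^ 2 := by linarith [sq_nonneg ε]

/-- The multiplier used to absorb the time derivative of the cut-off. -/
noncomputable def multiplier (n : ℕ) (c R : ℝ) (ψ : ℝ → ℝ) (p : SpaceTime n) : ℝ :=
  c * radial n R (-2 / 3) p * smoothSign ψ (1 / R ^ 2) p.2

theorem contDiffAt_multiplier (hψ : ContDiff ℝ ∞ ψ) (hR : 0 < R) (c : ℝ) (hp : p.1 ≠ 0) :
    ContDiffAt ℝ ∞ (multiplier n c R ψ) p :=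
  (contDiffAt_const.mul (contDiffAt_radial hp R _)).mul
    ((contDiff_smoothSign hψ (by positivity)).contDiffAt.comp p contDiffAt_snd)

theorem abs_dirDeriv_multiplier_le (hψ : ContDiff ℝ ∞ ψ) {c : ℝ} (hc : 0 ≤ c)
    (hp : p ∈ carlemanCylinder n R) (i : Fin n) :
    |dirDeriv (spaceDir n i) (multiplier n c R ψ) p| ≤ c * radial n R (-2 / 3) p := by
  obtain ⟨hr1, hrR, -⟩ := hp
  have hp0 : p.1 ≠ 0 := norm_pos_iff.1 (by linarith)
  have hr0 : 0 < ‖p.1‖ := by linarith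
  have hR : 0 < R := by linarith
  have hε : 0 < 1 / R ^ 2 := by positivity
  have h1 := (contDiffAt_radial hp0 R (-2 / 3)).differentiableAt (by simp)
  have h2 : DifferentiableAt ℝ (smoothSign ψ (1 / R ^ 2)) p.2 :=
    (contDiff_smoothSign hψ hε).differentiable (by simp) _
  have h3 : DifferentiableAt ℝ (fun q : SpaceTime n => smoothSign ψ (1 / R ^ 2) q.2) p :=
    h2.comp p differentiableAt_snd
  have hm2 : radial n R (-2 / 3) p = radial n R (-8 / 3) p * ‖p.1‖ ^ 2 := by
    rw [← radial_add hp0]; congr 1; norm_num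
  have e : dirDeriv (spaceDir n i) (multiplier n c R ψ) p
      = smoothSign ψ (1 / R ^ 2) p.2 * (-(2 / 3 * c * radial n R (-8 / 3) p) * p.1 i) := by
    change dirDeriv _ (fun q => c * radial n R (-2 / 3) q * smoothSign ψ (1 / R ^ 2) q.2) p = _
    rw [dirDeriv_mul (h1.const_mul c) h3, dirDeriv_comp_snd h2, dirDeriv_const_mul _ h1,
      dirDeriv_radial hp0, inner_spaceDir, spaceDir_snd,
      show (-2 / 3 - 2 : ℝ) = -8 / 3 by norm_num]
    ring
  have hm0 := radial_pos hp0 hR (-8 / 3)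
  have b : |-(2 / 3 * c * radial n R (-8 / 3) p) * p.1 i|
      ≤ 2 / 3 * c * radial n R (-8 / 3) p * ‖p.1‖ :=
    abs_mul_le_mul (by rw [abs_neg, abs_of_nonneg (by positivity)]) (abs_apply_le_norm _ _)
  rw [e]
  refine (abs_mul_le_mul (abs_smoothSign_le _ _) b).trans ?_
  rw [hm2]
  have h5 : ‖p.1‖ ≤ ‖p.1‖ ^ 2 := by nlinarith
  have h6 : c * radial n R (-8 / 3) p * ‖p.1‖ ≤ c * radial n R (-8 / 3) p * ‖p.1‖ ^ 2 := by gcongr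
  have h7 : 0 ≤ c * radial n R (-8 / 3) p * ‖p.1‖ := by positivity
  linarith

end WeightBounds

/-! ### Conjugation by the weight and return to the original function. -/

section Conjugation

variable {X : Type*} [NormedAddCommGroup X] [NormedSpace ℝ X] {n : ℕ}
  {a : Fin n → Fin n → X → ℝ} {e : Fin n → X} {τ : X} {Ψ u v W : X → ℝ} {p : X}

theorem dirDeriv_exp_mul (hΨ : ContDiff ℝ ∞ Ψ) (hv : ContDiff ℝ ∞ v) (w p : X) :
    dirDeriv w (fun x => Real.exp (Ψ x) * v x) p =
      Real.exp (Ψ p) * (dirDeriv w v p + dirDeriv w Ψ p * v p) := by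
  have h1 : HasFDerivAt Ψ (fderiv ℝ Ψ p) p := (hΨ.differentiable (by simp) p).hasFDerivAt
  have h2 : dirDeriv w (fun x => Real.exp (Ψ x)) p = Real.exp (Ψ p) * dirDeriv w Ψ p := by
    rw [h1.exp.dirDeriv_eq]; rfl
  rw [dirDeriv_mul h1.exp.differentiableAt (hv.differentiable (by simp) p), h2]
  ring

/-- The backward parabolic operator conjugated by `exp Ψ`. -/
theorem conjugated_operator_eq (ha : ∀ i j, DifferentiableAt ℝ (a i j) p)
    (hs : ∀ i j, a i j p = a j i p) (hΨ : ContDiff ℝ ∞ Ψ) (hv : ContDiff ℝ ∞ v)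
    (hu : u = fun x => Real.exp (Ψ x) * v x) :
    frameDiv e (flux a (frameGrad e u)) p + conjPotential a e τ Ψ p * u p
        + (dirDeriv τ u p - 2 * (∑ k, flux a (frameGrad e Ψ) k p * frameGrad e u k p)
            - frameDiv e (flux a (frameGrad e Ψ)) p * u p) =
      Real.exp (Ψ p) * (dirDeriv τ v p + frameDiv e (flux a (frameGrad e v)) p) := by
  have dif : ∀ {f : X → ℝ}, ContDiff ℝ ∞ f → DifferentiableAt ℝ f p :=
    fun h => (h.differentiable (by simp)) p
  have hgv : ∀ i, DifferentiableAt ℝ (frameGrad e v i) p := fun i => dif (hv.dirDeriv _)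
  have hgΨ : ∀ i, DifferentiableAt ℝ (frameGrad e Ψ i) p := fun i => dif (hΨ.dirDeriv _)
  have hq := DifferentiableAt.flux ha hgv
  have hb := DifferentiableAt.flux ha hgΨ
  have hv' := dif hv
  have hexp : DifferentiableAt ℝ (fun x => Real.exp (Ψ x)) p := (dif hΨ).exp
  have hg : ∀ k x, frameGrad e u k x
      = Real.exp (Ψ x) * (frameGrad e v k x + frameGrad e Ψ k x * v x) := by
    intro k x; rw [hu]; exact dirDeriv_exp_mul hΨ hv _ _
  have hfl : flux a (frameGrad e u) = fun i x => Real.exp (Ψ x) *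
      (flux a (frameGrad e v) i x + v x * flux a (frameGrad e Ψ) i x) := by
    funext i x
    simp only [flux, hg, Finset.mul_sum, ← Finset.sum_add_distrib]
    exact Finset.sum_congr rfl fun j _ => by ring
  have hsw : ∑ i, flux a (frameGrad e v) i p * frameGrad e Ψ i p
      = ∑ i, flux a (frameGrad e Ψ) i p * frameGrad e v i p := by
    simp only [flux, Finset.sum_mul]
    rw [Finset.sum_comm]
    refine Finset.sum_congr rfl fun i _ => Finset.sum_congr rfl fun j _ => ?_
    rw [hs j i]; ring
  have hL : frameDiv e (flux a (frameGrad e u)) p = Real.exp (Ψ p) *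
      (frameDiv e (flux a (frameGrad e v)) p + v p * frameDiv e (flux a (frameGrad e Ψ)) p
        + 2 * (∑ i, flux a (frameGrad e Ψ) i p * frameGrad e v i p)
        + energy a (frameGrad e Ψ) p * v p) := by
    have hd : ∀ i, dirDeriv (e i) (fun x => Real.exp (Ψ x)) p
        = Real.exp (Ψ p) * frameGrad e Ψ i p := fun i => by
      rw [(dif hΨ).hasFDerivAt.exp.dirDeriv_eq]; rfl
    rw [hfl, frameDiv_mul (fun i => (hq i).fun_add (hv'.fun_mul (hb i))) hexp,
      frameDiv_add hq (fun i => hv'.fun_mul (hb i)), frameDiv_mul hb hv']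
    have e1 : ∑ i, (flux a (frameGrad e v) i p + v p * flux a (frameGrad e Ψ) i p)
          * dirDeriv (e i) (fun x => Real.exp (Ψ x)) p
        = Real.exp (Ψ p) * (∑ i, flux a (frameGrad e v) i p * frameGrad e Ψ i p)
          + Real.exp (Ψ p) * v p * energy a (frameGrad e Ψ) p := by
      rw [energy, Finset.mul_sum, Finset.mul_sum, ← Finset.sum_add_distrib]
      refine Finset.sum_congr rfl fun i _ => ?_
      rw [hd]; ring
    have e2 : ∑ i, flux a (frameGrad e Ψ) i p * dirDeriv (e i) v p
        = ∑ i, flux a (frameGrad e Ψ) i p * frameGrad e v i p := rfl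
    rw [e1, hsw, e2]
    ring
  have hB : ∑ k, flux a (frameGrad e Ψ) k p * frameGrad e u k p
      = Real.exp (Ψ p) * (∑ i, flux a (frameGrad e Ψ) i p * frameGrad e v i p)
        + Real.exp (Ψ p) * v p * energy a (frameGrad e Ψ) p := by
    rw [energy, Finset.mul_sum, Finset.mul_sum, ← Finset.sum_add_distrib]
    refine Finset.sum_congr rfl fun i _ => ?_
    rw [hg]; ring
  have hut : dirDeriv τ u p = Real.exp (Ψ p) * (dirDeriv τ v p + dirDeriv τ Ψ p * v p) := by
    rw [hu]; exact dirDeriv_exp_mul hΨ hv _ _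
  have hup : u p = Real.exp (Ψ p) * v p := by rw [hu]
  rw [hL, hB, hut, hup, conjPotential]
  ring

/-- The weighted norms of `v` are controlled by those of `exp Ψ * v`. -/
theorem CarlemanPoint.weighted_le {lam Lam M E γ m r R K s : ℝ}
    (h : CarlemanPoint a e τ Ψ p lam Lam M E γ m r R K s) (hv : ContDiff ℝ ∞ v)
    (hu : u = fun x => Real.exp (Ψ x) * v x) :
    1 / 5000 * lam ^ 2 * (Real.exp (2 * Ψ p) *
        (γ ^ 3 * R ^ 2 * v p ^ 2 + γ * ∑ i, frameGrad e v i p ^ 2)) ≤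
      lam ^ 2 / 18 * (γ * m * ∑ i, frameGrad e u i p ^ 2)
        + lam ^ 2 / 486 * (γ ^ 3 * R ^ 2 * u p ^ 2) := by
  have hγ := h.one_le_γ
  have hm := h.one_le_m
  have hr := h.one_le_r
  have hup : u p = Real.exp (Ψ p) * v p := by rw [hu]
  have hexp : Real.exp (2 * Ψ p) = Real.exp (Ψ p) ^ 2 := by
    rw [← Real.exp_nat_mul]; norm_num
  have hg : ∀ k, Real.exp (Ψ p) * frameGrad e v k p
      = frameGrad e u k p - frameGrad e Ψ k p * u p := by
    intro k
    have : frameGrad e u k p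
        = Real.exp (Ψ p) * (frameGrad e v k p + frameGrad e Ψ k p * v p) := by
      rw [hu]; exact dirDeriv_exp_mul h.smooth hv _ _
    rw [this, hup]; ring
  set S := ∑ i, frameGrad e u i p ^ 2 with hS
  have hS0 : 0 ≤ S := Finset.sum_nonneg fun i _ => sq_nonneg _
  have h1 : Real.exp (Ψ p) ^ 2 * ∑ i, frameGrad e v i p ^ 2
      ≤ 2 * S + 2 * (∑ i, frameGrad e Ψ i p ^ 2) * u p ^ 2 := by
    rw [hS, Finset.mul_sum, Finset.mul_sum, Finset.mul_sum, Finset.sum_mul,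
      ← Finset.sum_add_distrib]
    refine Finset.sum_le_sum fun i _ => ?_
    rw [← mul_pow, hg]
    have := sq_nonneg (frameGrad e u i p + frameGrad e Ψ i p * u p)
    linarith
  have hmr : (m * r) ^ 2 ≤ R ^ 2 := pow_le_pow_left₀ (by positivity) h.mr_le 2
  have h2 : ∑ i, frameGrad e Ψ i p ^ 2 ≤ 4 * γ ^ 2 * R ^ 2 := by
    refine h.grad_upper.trans ?_
    calc _ = 4 * γ ^ 2 * (m * r) ^ 2 := by ring
      _ ≤ _ := by gcongr
  have h3 : Real.exp (Ψ p) ^ 2 * ∑ i, frameGrad e v i p ^ 2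
      ≤ 2 * S + 2 * (4 * γ ^ 2 * R ^ 2) * u p ^ 2 := h1.trans (by gcongr)
  have h4 : γ * (Real.exp (Ψ p) ^ 2 * ∑ i, frameGrad e v i p ^ 2)
      ≤ γ * (2 * S + 2 * (4 * γ ^ 2 * R ^ 2) * u p ^ 2) := by gcongr
  have h5 : γ * 1 * S ≤ γ * m * S := by gcongr
  have h6 : 0 ≤ γ ^ 3 * R ^ 2 * u p ^ 2 := by positivity
  have h7 : 0 ≤ γ * 1 * S := by positivity
  have e1 : Real.exp (2 * Ψ p) * (γ ^ 3 * R ^ 2 * v p ^ 2 + γ * ∑ i, frameGrad e v i p ^ 2)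
      = γ ^ 3 * R ^ 2 * u p ^ 2 + γ * (Real.exp (Ψ p) ^ 2 * ∑ i, frameGrad e v i p ^ 2) := by
    rw [hexp, hup]; ring
  rw [e1]
  -- Passing from ∇v to ∇u costs 8γ³R²u², so 9/5000 < 1/486 is what fixes the final constant; the
  -- gain of m ≥ 1 in the gradient term is discarded.
  have h8 : 1 / 5000 * (γ ^ 3 * R ^ 2 * u p ^ 2
      + γ * (Real.exp (Ψ p) ^ 2 * ∑ i, frameGrad e v i p ^ 2))
      ≤ 1 / 18 * (γ * m * S) + 1 / 486 * (γ ^ 3 * R ^ 2 * u p ^ 2) := by linarith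
  have := mul_le_mul_of_nonneg_left h8 (sq_nonneg lam)
  linarith

end Conjugation

/-! ### Supports, regularity and vanishing integral of the divergence. -/

section Support

variable {X : Type*} [NormedAddCommGroup X] [NormedSpace ℝ X] {n : ℕ}
  {a : Fin n → Fin n → X → ℝ} {e : Fin n → X} {τ : X} {Ψ u v W : X → ℝ} {p : X}

theorem dirDeriv_eq_zero_of_notMem_tsupport {f : X → ℝ} (hp : p ∉ tsupport f) (w : X) :
    dirDeriv w f p = 0 := by
  have h : f =ᶠ[nhds p] fun _ => 0 := notMem_tsupport_iff_eventuallyEq.1 hp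
  rw [h.dirDeriv_eq, dirDeriv_const]

theorem carlemanSpaceField_eq_zero (hp : p ∉ tsupport u) (i : Fin n) :
    carlemanSpaceField a e τ Ψ u W i p = 0 := by
  have h0 : u p = 0 := image_eq_zero_of_notMem_tsupport hp
  have h1 : ∀ k, frameGrad e u k p = 0 := fun k => dirDeriv_eq_zero_of_notMem_tsupport hp _
  simp [carlemanSpaceField, flux, energy, h0, h1]

theorem carlemanTimeField_eq_zero (hp : p ∉ tsupport u) :
    carlemanTimeField a e τ Ψ u p = 0 := by
  have h0 : u p = 0 := image_eq_zero_of_notMem_tsupport hp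
  have h1 : ∀ k, frameGrad e u k p = 0 := fun k => dirDeriv_eq_zero_of_notMem_tsupport hp _
  simp [carlemanTimeField, energy, h0, h1]

theorem notMem_tsupport_of_forall_notMem {X : Type*} [TopologicalSpace X] {f u : X → ℝ} {p : X}
     (h : ∀ q ∉ tsupport u, f q = 0)
    (hp : p ∉ tsupport u) : p ∉ tsupport f := by
  rw [notMem_tsupport_iff_eventuallyEq]
  filter_upwards [(isClosed_tsupport u).isOpen_compl.mem_nhds hp] with q hq using h q hq

/-- Lets the pointwise inequality hold trivially off the support, where the weight is modified and
the coefficients need not be elliptic. -/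
theorem divergence_eq_zero (hp : p ∉ tsupport u) :
    frameDiv e (carlemanSpaceField a e τ Ψ u W) p
      + dirDeriv τ (carlemanTimeField a e τ Ψ u) p = 0 := by
  have h1 : ∀ i, dirDeriv (e i) (carlemanSpaceField a e τ Ψ u W i) p = 0 := fun i =>
    dirDeriv_eq_zero_of_notMem_tsupport
      (notMem_tsupport_of_forall_notMem (fun q hq => carlemanSpaceField_eq_zero hq i) hp) _
  have h2 : dirDeriv τ (carlemanTimeField a e τ Ψ u) p = 0 :=
    dirDeriv_eq_zero_of_notMem_tsupport
      (notMem_tsupport_of_forall_notMem (fun q hq => carlemanTimeField_eq_zero hq) hp) _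
  simp [frameDiv, h1, h2]

theorem BddLipschitz.flux {X : Type*} [PseudoMetricSpace X] {a : Fin n → Fin n → X → ℝ}
    {f : Fin n → X → ℝ} (ha : ∀ i j, BddLipschitz (a i j))
    (hf : ∀ i, BddLipschitz (f i)) (i : Fin n) : BddLipschitz (flux a f i) :=
  BddLipschitz.sum _ fun j => (ha i j).mul (hf j)

theorem BddLipschitz.energy {X : Type*} [PseudoMetricSpace X] {a : Fin n → Fin n → X → ℝ}
    {f : Fin n → X → ℝ} (ha : ∀ i j, BddLipschitz (a i j))
    (hf : ∀ i, BddLipschitz (f i)) : BddLipschitz (energy a f) :=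
  BddLipschitz.sum _ fun i => (BddLipschitz.flux ha hf i).mul (hf i)

theorem BddLipschitz.of_contDiff_top {f : X → ℝ} (hf : ContDiff ℝ ∞ f)
    (hc : HasCompactSupport f) : BddLipschitz f :=
  .of_contDiff (hf.of_le (by exact_mod_cast le_top)) hc

section

variable (ha : ∀ i j, BddLipschitz (a i j)) (hΨ : ContDiff ℝ ∞ Ψ) (hΨc : HasCompactSupport Ψ)
  (hu : ContDiff ℝ ∞ u) (huc : HasCompactSupport u) (hW : ContDiff ℝ ∞ W)
  (hWc : HasCompactSupport W)
include ha hΨ hΨc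

theorem BddLipschitz.conjPotential : BddLipschitz (conjPotential a e τ Ψ) :=
  (BddLipschitz.energy ha fun _ => .of_contDiff_top (hΨ.dirDeriv _) (hΨc.dirDeriv _)).sub
    (.of_contDiff_top (hΨ.dirDeriv _) (hΨc.dirDeriv _))

include hu huc

theorem BddLipschitz.carlemanTimeField : BddLipschitz (carlemanTimeField a e τ Ψ u) := by
  have hu' := BddLipschitz.of_contDiff_top hu huc
  exact ((BddLipschitz.conjPotential ha hΨ hΨc).mul (hu'.mul hu')).sub
    (BddLipschitz.energy ha fun _ => .of_contDiff_top (hu.dirDeriv _) (huc.dirDeriv _))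

include hW hWc in
theorem BddLipschitz.carlemanSpaceField (i : Fin n) :
    BddLipschitz (carlemanSpaceField a e τ Ψ u W i) := by
  have hu' := BddLipschitz.of_contDiff_top hu huc
  have hut : BddLipschitz (dirDeriv τ u) := .of_contDiff_top (hu.dirDeriv _) (huc.dirDeriv _)
  have hgu : ∀ i, BddLipschitz (frameGrad e u i) := fun _ =>
    .of_contDiff_top (hu.dirDeriv _) (huc.dirDeriv _)
  have hq := BddLipschitz.flux ha hgu
  have hb := BddLipschitz.flux (f := frameGrad e Ψ) ha fun _ =>
    .of_contDiff_top (hΨ.dirDeriv _) (hΨc.dirDeriv _)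
  have hQ := BddLipschitz.energy ha hgu
  have hG : BddLipschitz (hessTrace a e Ψ) := BddLipschitz.sum _ fun i => BddLipschitz.sum _ fun j =>
    (ha i j).mul (.of_contDiff_top ((hΨ.dirDeriv _).dirDeriv _) ((hΨc.dirDeriv _).dirDeriv _))
  have hF := BddLipschitz.conjPotential (e := e) (τ := τ) ha hΨ hΨc
  have hW' := BddLipschitz.of_contDiff_top hW hWc
  have hB := BddLipschitz.sum Finset.univ fun k => (hb k).mul (hgu k)
  exact ((((((hq i).mul hut).const_mul 2).sub (((hq i).mul hB).const_mul 4)).add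
    (((hb i).mul hQ).const_mul 2)).sub (((hG.mul hu').mul (hq i)).const_mul 2)).sub
      (((hF.mul (hu'.mul hu')).mul (hb i)).const_mul 2) |>.add ((hW'.mul hu').mul (hq i))

variable [MeasurableSpace X] [BorelSpace X] (μ : Measure X)
  [μ.IsAddHaarMeasure]

include hW hWc in
theorem integrable_divergence : Integrable (fun p => frameDiv e (carlemanSpaceField a e τ Ψ u W) p
    + dirDeriv τ (carlemanTimeField a e τ Ψ u) p) μ := by
  refine Integrable.add (integrable_finsetSum _ fun i _ => ?_) ?_
  · exact integrable_dirDeriv μ (BddLipschitz.carlemanSpaceField ha hΨ hΨc hu huc hW hWc i)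
      (HasCompactSupport.intro huc fun q hq => carlemanSpaceField_eq_zero hq i) _
  · exact integrable_dirDeriv μ (BddLipschitz.carlemanTimeField ha hΨ hΨc hu huc)
      (HasCompactSupport.intro huc fun q hq => carlemanTimeField_eq_zero hq) _

include hW hWc in
theorem integral_divergence_eq_zero [FiniteDimensional ℝ X] :
    ∫ p, (frameDiv e (carlemanSpaceField a e τ Ψ u W) p
      + dirDeriv τ (carlemanTimeField a e τ Ψ u) p) ∂μ = 0 := by
  have h1 : ∀ i, HasCompactSupport (carlemanSpaceField a e τ Ψ u W i) := fun i =>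
    HasCompactSupport.intro huc fun q hq => carlemanSpaceField_eq_zero hq i
  have h2 : HasCompactSupport (carlemanTimeField a e τ Ψ u) :=
    HasCompactSupport.intro huc fun q hq => carlemanTimeField_eq_zero hq
  have b1 := BddLipschitz.carlemanSpaceField (e := e) (τ := τ) ha hΨ hΨc hu huc hW hWc
  have b2 := BddLipschitz.carlemanTimeField (e := e) (τ := τ) ha hΨ hΨc hu huc
  have i1 : ∀ i ∈ Finset.univ,
      Integrable (dirDeriv (e i) (carlemanSpaceField a e τ Ψ u W i)) μ :=
    fun i _ => integrable_dirDeriv μ (b1 i) (h1 i) _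
  simp only [frameDiv]
  rw [integral_add (integrable_finsetSum _ i1) (integrable_dirDeriv μ b2 h2 _),
    integral_finsetSum _ i1, integral_dirDeriv_eq_zero μ b2 h2]
  simp [integral_dirDeriv_eq_zero μ (b1 _) (h1 _)]

end

end Support

/-! ### Localization to a neighbourhood of the support. -/

/-- A function that is smooth near a compact set agrees near this set with a smooth function of
compact support. -/
theorem exists_contDiff_hasCompactSupport_eventuallyEq {X : Type*} [NormedAddCommGroup X]
    [NormedSpace ℝ X] [FiniteDimensional ℝ X] {K U : Set X} (hK : IsCompact K) (hU : IsOpen U)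
    (hKU : K ⊆ U) {g : X → ℝ} (hg : ∀ p ∈ U, ContDiffAt ℝ ∞ g p) :
    ∃ f : X → ℝ, ContDiff ℝ ∞ f ∧ HasCompactSupport f ∧ ∀ p ∈ K, f =ᶠ[nhds p] g := by
  obtain ⟨L, hL, hKL, hLU⟩ := exists_compact_between hK hU hKU
  obtain ⟨χ, h1, h0, -⟩ := exists_contMDiffMap_one_nhds_of_subset_interior
    (n := (⊤ : ℕ∞)) (modelWithCornersSelf ℝ X) hK.isClosed hKL
  have hχ : ContDiff ℝ ∞ χ := χ.contMDiff.contDiff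
  refine ⟨fun p => χ p * g p, contDiff_iff_contDiffAt.2 fun p => ?_,
    HasCompactSupport.intro hL fun p hp => by simp [h0 p hp], fun p hp => ?_⟩
  · by_cases hp : p ∈ L
    · exact hχ.contDiffAt.mul (hg p (hLU hp))
    · have : (fun q => χ q * g q) =ᶠ[nhds p] fun _ => 0 := by
        filter_upwards [hL.isClosed.isOpen_compl.mem_nhds hp] with q hq
        simp [h0 q hq]
      exact contDiffAt_const.congr_of_eventuallyEq this
  · have : ∀ᶠ q in nhds p, χ q = 1 := Filter.eventually_iff_exists_mem.2 <| by
      obtain ⟨s, hs, hs'⟩ := Filter.eventually_iff_exists_mem.1 h1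
      exact ⟨s, nhds_le_nhdsSet hp hs, hs'⟩
    filter_upwards [this] with q hq
    simp [hq]

instance (n : ℕ) : (volume : Measure (SpaceTime n)).IsAddHaarMeasure :=
  inferInstanceAs ((volume : Measure (EuclideanSpace ℝ (Fin n))).prod
    (volume : Measure ℝ)).IsAddHaarMeasure

/-! ### Partial derivatives as directional derivatives in space-time. -/

section Slices

variable {n : ℕ} {g : SpaceTime n → ℝ} {p : SpaceTime n}

theorem hasFDerivAt_spaceSlice (hg : DifferentiableAt ℝ g p) :
    HasFDerivAt (fun y => g (y, p.2))
      ((fderiv ℝ g p).comp (ContinuousLinearMap.inl ℝ (EuclideanSpace ℝ (Fin n)) ℝ)) p.1 :=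
  HasFDerivAt.comp (g := g) p.1 (f := fun y => (y, p.2)) hg.hasFDerivAt
    (hasFDerivAt_prodMk_left p.1 p.2)

theorem lineDeriv_spaceSlice (hg : DifferentiableAt ℝ g p) (i : Fin n) :
    lineDeriv ℝ (fun y => g (y, p.2)) p.1 (EuclideanSpace.single i 1)
      = dirDeriv (spaceDir n i) g p := by
  rw [(hasFDerivAt_spaceSlice hg).differentiableAt.lineDeriv_eq_fderiv,
    (hasFDerivAt_spaceSlice hg).fderiv]
  rfl

theorem gradient_spaceSlice_apply (hg : DifferentiableAt ℝ g p) (i : Fin n) :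
    (∇ (fun y => g (y, p.2)) p.1) i = dirDeriv (spaceDir n i) g p := by
  have h : inner ℝ (∇ (fun y => g (y, p.2)) p.1) (EuclideanSpace.single i 1)
      = fderiv ℝ (fun y => g (y, p.2)) p.1 (EuclideanSpace.single i 1) := by
    rw [← toDual_gradient]; rfl
  rw [(hasFDerivAt_spaceSlice hg).fderiv] at h
  rw [EuclideanSpace.inner_single_right, one_mul] at h
  exact h

theorem deriv_timeSlice (hg : DifferentiableAt ℝ g p) :
    deriv (fun s => g (p.1, s)) p.2 = dirDeriv (timeDir n) g p := by
  have h : HasFDerivAt (fun s => g (p.1, s))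
      ((fderiv ℝ g p).comp (ContinuousLinearMap.inr ℝ (EuclideanSpace ℝ (Fin n)) ℝ)) p.2 :=
    HasFDerivAt.comp (g := g) p.2 (f := fun s => (p.1, s)) hg.hasFDerivAt
      (hasFDerivAt_prodMk_right p.1 p.2)
  rw [h.hasDerivAt.deriv]; rfl

end Slices

/-! ### Extension of the coefficients and identification of the operator. -/

section Coefficients

variable {n : ℕ} {lam Lam M E : ℝ} {A : EuclideanSpace ℝ (Fin n) → ℝ → Matrix (Fin n) (Fin n) ℝ}

/-- Polarization: the quadratic form at e_i + e_j and at e_i - e_j lies in [0, 4Λ], and the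
difference of the two values is 4a^{ij}. -/
theorem AdmissibleCoefficients.abs_entry_le (hA : AdmissibleCoefficients lam Lam M E A)
    (hlam : 0 < lam) (hLam : lam ≤ Lam) {p : SpaceTime n} (hp : p ∈ exteriorDomain n)
    (i j : Fin n) : |A p.1 p.2 i j| ≤ Lam := by
  have hs : A p.1 p.2 j i = A p.1 p.2 i j := (hA.symm p hp).apply i j
  have key : ∀ s : ℝ, s ^ 2 = 1 →
      A p.1 p.2 i i + 2 * s * A p.1 p.2 i j + A p.1 p.2 j j ∈ Icc 0 (4 * Lam) := by
    intro s hs1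
    set ξ : EuclideanSpace ℝ (Fin n) := EuclideanSpace.single i 1 + EuclideanSpace.single j s
      with hξ
    have h := hA.elliptic p hp ξ
    have e : ∑ k, ∑ l, A p.1 p.2 k l * ξ k * ξ l
        = A p.1 p.2 i i + 2 * s * A p.1 p.2 i j + A p.1 p.2 j j := by
      simp [hξ, mul_add, add_mul, Finset.sum_add_distrib]
      rw [hs]
      linear_combination A p.1 p.2 j j * hs1
    -- The triangle inequality rather than orthogonality, so that i = j is covered.
    have hn : ‖ξ‖ ≤ 2 := by
      refine (norm_add_le _ _).trans ?_
      have : |s| = 1 := by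
        rw [← Real.sqrt_sq_eq_abs, hs1, Real.sqrt_one]
      simp [this]; norm_num
    have hn2 : ‖ξ‖ ^ 2 ≤ 4 := by nlinarith [norm_nonneg ξ]
    rw [e] at h
    refine ⟨le_trans (by positivity) h.1, h.2.trans ?_⟩
    nlinarith
  have h1 := key 1 (by norm_num)
  have h2 := key (-1) (by norm_num)
  rw [abs_le]
  constructor <;> linarith [h1.1, h1.2, h2.1, h2.2]

/-- A Lipschitz extension of each entry, truncated at ±Λ to keep it bounded. Symmetry and
ellipticity may be lost off the exterior domain, but they are needed only in the cylinder. -/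
theorem AdmissibleCoefficients.exists_extension (hA : AdmissibleCoefficients lam Lam M E A)
    (hlam : 0 < lam) (hLam : lam ≤ Lam) :
    ∃ a : Fin n → Fin n → SpaceTime n → ℝ, (∀ i j, BddLipschitz (a i j)) ∧
      ∀ p ∈ exteriorDomain n, ∀ i j, a i j p = A p.1 p.2 i j := by
  have h : ∀ i j, ∃ a : SpaceTime n → ℝ, BddLipschitz a ∧
      ∀ p ∈ exteriorDomain n, a p = A p.1 p.2 i j := by
    intro i j
    obtain ⟨K, hK⟩ := hA.lipschitz i j
    obtain ⟨g, hg, hgA⟩ := hK.extend_real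
    refine ⟨fun p => max (-Lam) (min (g p) Lam), ⟨⟨K, (hg.min_const _).const_max _⟩, Lam,
      fun p => abs_le.2 ⟨le_max_left _ _, max_le (by linarith) (min_le_right _ _)⟩⟩,
      fun p hp => ?_⟩
    have hb := abs_le.1 (hA.abs_entry_le hlam hLam hp i j)
    have e : g p = A p.1 p.2 i j := (hgA hp).symm
    simp only [e]
    rw [min_eq_left hb.2, max_eq_right hb.1]
  choose a ha using h
  exact ⟨a, fun i j => (ha i j).1, fun p hp i j => (ha i j).2 p hp⟩

theorem isOpen_carlemanCylinder (n : ℕ) (R : ℝ) : IsOpen (carlemanCylinder n R) :=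
  (isOpen_lt continuous_const continuous_fst.norm).inter
    ((isOpen_lt continuous_fst.norm continuous_const).inter
      (isOpen_Ioo.preimage continuous_snd))

theorem carlemanCylinder_subset_exteriorDomain (n : ℕ) (R : ℝ) :
    carlemanCylinder n R ⊆ exteriorDomain n := fun _ hp =>
  ⟨hp.1.le, by linarith [hp.2.2.1], by linarith [hp.2.2.2]⟩

variable {a : Fin n → Fin n → SpaceTime n → ℝ} {R : ℝ}

theorem eventuallyEq_coefficients
    (haA : ∀ p ∈ exteriorDomain n, ∀ i j, a i j p = A p.1 p.2 i j)
    {p : SpaceTime n} (hp : p ∈ carlemanCylinder n R) (i j : Fin n) :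
    (fun q : SpaceTime n => A q.1 q.2 i j) =ᶠ[nhds p] a i j := by
  filter_upwards [(isOpen_carlemanCylinder n R).mem_nhds hp] with q hq
  exact (haA q (carlemanCylinder_subset_exteriorDomain n R hq) i j).symm

/-- Rademacher's theorem applies to the extension in space-time; as the cylinder is open and
contained in the exterior domain, slice derivatives of A there are directional derivatives of the
extension. -/
theorem AdmissibleCoefficients.ae_derivative_bounds (hA : AdmissibleCoefficients lam Lam M E A)
    (ha : ∀ i j, BddLipschitz (a i j))
    (haA : ∀ p ∈ exteriorDomain n, ∀ i j, a i j p = A p.1 p.2 i j) (R : ℝ) :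
    ∀ᵐ p : SpaceTime n, p ∈ carlemanCylinder n R → ∀ i j, DifferentiableAt ℝ (a i j) p ∧
      (∀ k, |dirDeriv (spaceDir n k) (a i j) p| ≤ E / ‖p.1‖) ∧
      |dirDeriv (timeDir n) (a i j) p| ≤ M := by
  have hmeas : MeasurableSet (exteriorDomain n) :=
    ((isClosed_le continuous_const continuous_fst.norm).inter
      (isClosed_Icc.preimage continuous_snd)).measurableSet
  have h1 : ∀ᵐ p : SpaceTime n, ∀ i j, DifferentiableAt ℝ (a i j) p :=
    ae_all_iff.2 fun i => ae_all_iff.2 fun j => (ha i j).differentiableAt_ae volume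
  have h2 : ∀ᵐ p : SpaceTime n, ∀ i j, p ∈ exteriorDomain n →
      ‖∇ (fun y => A y p.2 i j) p.1‖ + |deriv (fun s => A p.1 s i j) p.2| ≤ M :=
    ae_all_iff.2 fun i => ae_all_iff.2 fun j =>
      (ae_restrict_iff' hmeas).1 (hA.deriv_bound i j)
  have h3 : ∀ᵐ p : SpaceTime n, ∀ i j, p ∈ exteriorDomain n →
      ‖∇ (fun y => A y p.2 i j) p.1‖ ≤ E / ‖p.1‖ :=
    ae_all_iff.2 fun i => ae_all_iff.2 fun j =>
      (ae_restrict_iff' hmeas).1 (hA.grad_decay i j)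
  filter_upwards [h1, h2, h3] with p hd hM hE hp i j
  have hpD := carlemanCylinder_subset_exteriorDomain n R hp
  have hev := eventuallyEq_coefficients haA hp i j
  have hdA : DifferentiableAt ℝ (fun q : SpaceTime n => A q.1 q.2 i j) p :=
    hev.differentiableAt_iff.2 (hd i j)
  refine ⟨hd i j, fun k => ?_, ?_⟩
  · rw [← hev.dirDeriv_eq, ← gradient_spaceSlice_apply hdA k]
    exact (abs_apply_le_norm _ k).trans (hE i j hpD)
  · rw [← hev.dirDeriv_eq, ← deriv_timeSlice hdA]
    exact le_trans (le_add_of_nonneg_left (norm_nonneg _)) (hM i j hpD)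

theorem backwardParabolic_eq
    (haA : ∀ p ∈ exteriorDomain n, ∀ i j, a i j p = A p.1 p.2 i j)
    {v : SpaceTime n → ℝ} (hv : ContDiff ℝ ∞ v) {p : SpaceTime n} (hp : p ∈ carlemanCylinder n R)
    (hd : ∀ i j, DifferentiableAt ℝ (a i j) p) :
    backwardParabolic A v p = dirDeriv (timeDir n) v p
      + frameDiv (spaceDir n) (flux a (frameGrad (spaceDir n) v)) p := by
  have dif : ∀ {f : SpaceTime n → ℝ}, ContDiff ℝ ∞ f → Differentiable ℝ f :=
    fun h => h.differentiable (by simp)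
  have h1 : deriv (fun s => v (p.1, s)) p.2 = dirDeriv (timeDir n) v p :=
    deriv_timeSlice (dif hv p)
  rw [backwardParabolic, h1, frameDiv]
  congr 1
  refine Finset.sum_congr rfl fun i _ => ?_
  have h2 : ∀ j, DifferentiableAt ℝ (fun q => a i j q * frameGrad (spaceDir n) v j q) p :=
    fun j => (hd i j).mul (dif (hv.dirDeriv _) p)
  have h3 : dirDeriv (spaceDir n i) (flux a (frameGrad (spaceDir n) v) i) p
      = ∑ j, dirDeriv (spaceDir n i) (fun q => a i j q * frameGrad (spaceDir n) v j q) p :=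
    dirDeriv_sum _ h2
  rw [h3]
  refine Finset.sum_congr rfl fun j _ => ?_
  rw [← lineDeriv_spaceSlice (h2 j) i]
  refine Filter.EventuallyEq.lineDeriv_eq ?_
  have hc : Continuous fun y : EuclideanSpace ℝ (Fin n) => (y, p.2) := by fun_prop
  have hev := (hc.tendsto p.1).eventually (eventuallyEq_coefficients haA hp i j)
  filter_upwards [hev] with y hy
  have hy' : A y p.2 i j = a i j (y, p.2) := hy
  rw [hy']
  congr 1
  exact lineDeriv_spaceSlice (p := (y, p.2)) (dif hv _) j

end Coefficients

/-! ### Integration and choice of constants. -/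

section Main

variable {n : ℕ}

/-- The conjugated Carleman estimate for Lipschitz coefficients defined on all of space-time. -/
theorem carleman_integral_inequality {a : Fin n → Fin n → SpaceTime n → ℝ}
    {v : SpaceTime n → ℝ} {ψ : ℝ → ℝ} {lam Lam M E γ R K : ℝ}
    (ha : ∀ i j, BddLipschitz (a i j))
    (symm : ∀ p ∈ carlemanCylinder n R, ∀ i j, a i j p = a j i p)
    (ell : ∀ p ∈ carlemanCylinder n R, ∀ ξ : Fin n → ℝ,
      lam * ∑ i, ξ i ^ 2 ≤ ∑ i, ∑ j, a i j p * ξ i * ξ j ∧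
        ∑ i, ∑ j, a i j p * ξ i * ξ j ≤ Lam * ∑ i, ξ i ^ 2)
    (entry : ∀ p ∈ carlemanCylinder n R, ∀ i j, |a i j p| ≤ Lam)
    (bounds : ∀ᵐ p : SpaceTime n, p ∈ carlemanCylinder n R → ∀ i j,
      DifferentiableAt ℝ (a i j) p ∧
      (∀ k, |dirDeriv (spaceDir n k) (a i j) p| ≤ E / ‖p.1‖) ∧
      |dirDeriv (timeDir n) (a i j) p| ≤ M)
    (hlam : 0 < lam) (hLam : lam ≤ Lam) (hM : 0 < M) (hE : 0 < E) (hE1 : E ≤ 1)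
    (hsmall : E * smallnessConst n Lam ≤ lam ^ 2)
    (hψ : ContDiff ℝ ∞ ψ) (hK : ∀ t ∈ Icc (0 : ℝ) 1, |deriv (deriv ψ) t| ≤ K)
    (hγ : 1 ≤ γ) (hlarge : lowerOrderConst n lam Lam M K ≤ lam ^ 2 * γ) (hR : 0 < R)
    (hv : ContDiff ℝ ∞ v) (hvc : HasCompactSupport v) (hvs : tsupport v ⊆ carlemanCylinder n R) :
    1 / 5000 * lam ^ 2 * (∫ p in carlemanCylinder n R, Real.exp (2 * carlemanWeight γ R ψ p) *
        (γ ^ 3 * R ^ 2 * v p ^ 2 + γ * ∑ i, frameGrad (spaceDir n) v i p ^ 2)) ≤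
      ∫ p in carlemanCylinder n R, Real.exp (2 * carlemanWeight γ R ψ p) *
        (dirDeriv (timeDir n) v p
          + frameDiv (spaceDir n) (flux a (frameGrad (spaceDir n) v)) p) ^ 2 := by
  have hne : ∀ p ∈ carlemanCylinder n R, p.1 ≠ 0 := fun p hp =>
    norm_pos_iff.1 (by linarith [hp.1])
  have hopen := isOpen_carlemanCylinder n R
  have hvK : IsCompact (tsupport v) := hvc
  -- The weight is not smooth at x = 0 and not compactly supported. It is replaced by a function
  -- agreeing with it near each point of the support of `v`, so that all derivatives agree there;
  -- likewise for the multiplier.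
  obtain ⟨Ψ, hΨ, hΨc, hΨe⟩ := exists_contDiff_hasCompactSupport_eventuallyEq hvK hopen hvs
    (g := carlemanWeight γ R ψ) fun p hp => contDiffAt_carlemanWeight hψ (hne p hp)
  obtain ⟨W, hW, hWc, hWe⟩ := exists_contDiff_hasCompactSupport_eventuallyEq hvK hopen hvs
    (g := multiplier n (4 * n ^ 2 * E * γ) R ψ) fun p hp => contDiffAt_multiplier hψ hR _ (hne p hp)
  set e := spaceDir n with he
  set τ := timeDir n with hτ
  obtain ⟨u, hu⟩ : ∃ u : SpaceTime n → ℝ, u = fun x => Real.exp (Ψ x) * v x := ⟨_, rfl⟩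
  have huS : ContDiff ℝ ∞ u := by rw [hu]; exact hΨ.exp.mul hv
  have hu0 : ∀ p ∉ tsupport v, u p = 0 := fun p hp => by
    rw [hu]; simp [image_eq_zero_of_notMem_tsupport hp]
  have huc : HasCompactSupport u := HasCompactSupport.intro hvK hu0
  set G : SpaceTime n → ℝ := fun p => Real.exp (2 * Ψ p) *
    (γ ^ 3 * R ^ 2 * v p ^ 2 + γ * ∑ i, frameGrad e v i p ^ 2) with hG
  set Pv : SpaceTime n → ℝ := fun p => dirDeriv τ v p + frameDiv e (flux a (frameGrad e v)) p
    with hPv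
  have hv0 : ∀ p ∉ tsupport v, v p = 0 ∧ (∀ i, frameGrad e v i p = 0) ∧ Pv p = 0 := by
    intro p hp
    have hfl : ∀ i, ∀ q ∉ tsupport v, flux a (frameGrad e v) i q = 0 := fun i q hq => by
      have : ∀ k, frameGrad e v k q = 0 := fun k => dirDeriv_eq_zero_of_notMem_tsupport hq _
      simp [flux, this]
    have hdiv : ∀ i, dirDeriv (e i) (flux a (frameGrad e v) i) p = 0 := fun i =>
      dirDeriv_eq_zero_of_notMem_tsupport (notMem_tsupport_of_forall_notMem (hfl i) hp) _
    refine ⟨image_eq_zero_of_notMem_tsupport hp,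
      fun i => dirDeriv_eq_zero_of_notMem_tsupport hp _, ?_⟩
    simp [hPv, frameDiv, hdiv, dirDeriv_eq_zero_of_notMem_tsupport hp]
  -- the pointwise inequality
  have hpt : ∀ᵐ p : SpaceTime n, 1 / 5000 * lam ^ 2 * G p
      + (frameDiv e (carlemanSpaceField a e τ Ψ u W) p
        + dirDeriv τ (carlemanTimeField a e τ Ψ u) p) ≤ Real.exp (2 * Ψ p) * Pv p ^ 2 := by
    filter_upwards [bounds] with p hb
    by_cases hp : p ∈ tsupport v
    · have hpQ := hvs hp
      have hb' := hb hpQ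
      have hCP : CarlemanPoint a e τ Ψ p lam Lam M E γ (radial n R (-2 / 3) p) ‖p.1‖ R K
          (deriv ψ p.2) :=
        carlemanPoint_of_mem hpQ hγ hψ hK hΨ (hΨe p hp) (fun i j => (hb' i j).1) (symm p hpQ)
          (fun ξ => (ell p hpQ ξ).1) (fun ξ => (ell p hpQ ξ).2) (entry p hpQ)
          (fun k i j => (hb' i j).2.1 k) (fun i j => (hb' i j).2.2) hlam hLam hE hE1 hM
      have hWp : W p = 4 * n ^ 2 * E * (γ * radial n R (-2 / 3) p)
          * smoothSign ψ (1 / R ^ 2) p.2 := by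
        rw [(hWe p hp).eq_of_nhds, multiplier]; ring
      have hdW : ∀ i, |dirDeriv (e i) W p| ≤ 4 * n ^ 2 * E * (γ * radial n R (-2 / 3) p) := by
        intro i
        rw [(hWe p hp).dirDeriv_eq]
        refine (abs_dirDeriv_multiplier_le hψ (by positivity) hpQ i).trans (le_of_eq (by ring))
      have h1 := hCP.pointwise_inequality huS hW hWp (abs_smoothSign_le _ _)
        (abs_deriv_sub_le_smoothSign (by positivity) _) hdW hsmall hlarge
      rw [conjugated_operator_eq hCP.diff hCP.symm hΨ hv hu] at h1
      have h2 := hCP.weighted_le hv hu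
      have h3 : Real.exp (2 * Ψ p) * Pv p ^ 2 = (Real.exp (Ψ p) * Pv p) ^ 2 := by
        rw [mul_pow, ← Real.exp_nat_mul]; norm_num
      rw [h3]
      exact (add_le_add_left h2 _).trans h1
    · have hpu : p ∉ tsupport u := notMem_tsupport_of_forall_notMem hu0 hp
      obtain ⟨h1, h2, h3⟩ := hv0 p hp
      rw [divergence_eq_zero hpu]
      simp [hG, h1, h2, h3]
  -- integrability
  have hGint : Integrable G := by
    refine Continuous.integrable_of_hasCompactSupport ?_ (HasCompactSupport.intro hvK ?_)
    · have h1 : ∀ i, Continuous (frameGrad e v i) := fun i => (hv.dirDeriv _).continuous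
      have h2 := hv.continuous
      have h3 := hΨ.continuous
      fun_prop
    · intro p hp
      obtain ⟨h1, h2, -⟩ := hv0 p hp
      simp [hG, h1, h2]
  have hPint : Integrable fun p => Real.exp (2 * Ψ p) * Pv p ^ 2 := by
    have hflux : ∀ i, BddLipschitz (flux a (frameGrad e v) i) := BddLipschitz.flux ha fun _ =>
      .of_contDiff_top (hv.dirDeriv _) (hvc.dirDeriv _)
    have hb1 : ∀ i, ∃ C, ∀ p, |dirDeriv (e i) (flux a (frameGrad e v) i) p| ≤ C := fun i => by
      obtain ⟨C, hC⟩ := (hflux i).lipschitz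
      exact ⟨_, hC.abs_dirDeriv_le (e i)⟩
    choose C hC using hb1
    obtain ⟨C', hC'⟩ := (BddLipschitz.of_contDiff_top (hv.dirDeriv τ) (hvc.dirDeriv τ)).bdd
    obtain ⟨C'', hC''⟩ := (BddLipschitz.of_contDiff_top hΨ hΨc).bdd
    have hbP : ∀ p, |Pv p| ≤ C' + ∑ i, C i := fun p =>
      (abs_add_le _ _).trans (add_le_add (hC' p) ((Finset.abs_sum_le_sum_abs _ _).trans
        (Finset.sum_le_sum fun i _ => hC i p)))
    refine integrable_of_bdd_of_hasCompactSupport volume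
      (C := Real.exp (2 * C'') * (C' + ∑ i, C i) ^ 2) ?_ (fun p => ?_)
      (HasCompactSupport.intro hvK fun p hp => by simp [(hv0 p hp).2.2])
    · have h1 : Measurable Pv := (measurable_dirDeriv _ _).add
        (Finset.measurable_fun_sum _ fun i _ => measurable_dirDeriv _ _)
      exact ((hΨ.continuous.measurable.const_mul 2).exp).mul (h1.pow_const 2)
    · refine abs_mul_le_mul ?_ ?_
      · rw [Real.abs_exp]
        exact Real.exp_le_exp.2 (by linarith [(abs_le.1 (hC'' p)).2])
      · rw [abs_pow]
        exact pow_le_pow_left₀ (abs_nonneg _) (hbP p) 2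
  have hdivint := integrable_divergence (e := e) (τ := τ) ha hΨ hΨc huS huc hW hWc volume
  have hdiv0 := integral_divergence_eq_zero (e := e) (τ := τ) ha hΨ hΨc huS huc hW hWc volume
  -- The divergence integrates to zero, which leaves the weighted norms.
  have hint := integral_mono_ae ((hGint.const_mul (1 / 5000 * lam ^ 2)).add hdivint) hPint hpt
  have e1 : ∫ p, (fun p => 1 / 5000 * lam ^ 2 * G p) p
      + (frameDiv e (carlemanSpaceField a e τ Ψ u W) p
        + dirDeriv τ (carlemanTimeField a e τ Ψ u) p) = 1 / 5000 * lam ^ 2 * ∫ p, G p := by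
    rw [integral_add (hGint.const_mul _) hdivint, hdiv0, add_zero, integral_const_mul]
  -- restriction to the cylinder
  have hΨeq : ∀ p ∈ tsupport v, Ψ p = carlemanWeight γ R ψ p := fun p hp => (hΨe p hp).eq_of_nhds
  have r1 : ∫ p in carlemanCylinder n R, Real.exp (2 * carlemanWeight γ R ψ p) *
      (γ ^ 3 * R ^ 2 * v p ^ 2 + γ * ∑ i, frameGrad e v i p ^ 2) = ∫ p, G p := by
    have hz : ∀ p ∉ carlemanCylinder n R, G p = 0 := fun p hp => by
      obtain ⟨h1, h2, -⟩ := hv0 p fun h => hp (hvs h)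
      simp [hG, h1, h2]
    rw [← setIntegral_eq_integral_of_forall_compl_eq_zero hz]
    congr 1
    funext p
    by_cases hp : p ∈ tsupport v
    · simp only [hG, hΨeq p hp]
    · obtain ⟨h1, h2, -⟩ := hv0 p hp
      simp [hG, h1, h2]
  have r2 : ∫ p in carlemanCylinder n R, Real.exp (2 * carlemanWeight γ R ψ p) * Pv p ^ 2
      = ∫ p, Real.exp (2 * Ψ p) * Pv p ^ 2 := by
    have hz : ∀ p ∉ carlemanCylinder n R, Real.exp (2 * Ψ p) * Pv p ^ 2 = 0 := fun p hp => by
      simp [(hv0 p fun h => hp (hvs h)).2.2]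
    rw [← setIntegral_eq_integral_of_forall_compl_eq_zero hz]
    congr 1
    funext p
    by_cases hp : p ∈ tsupport v
    · rw [hΨeq p hp]
    · simp [(hv0 p hp).2.2]
  rw [r1, r2, ← e1]
  exact hint

end Main

theorem proposition1p7 :
    ∃ c : ℝ, 0 < c ∧ ∀ (n : ℕ) (lam Lam : ℝ), 0 < lam → lam ≤ Lam →
      ∃ E₀ : ℝ, 0 < E₀ ∧ ∀ (M E : ℝ), 0 < M → 0 < E → E < E₀ →
        ∀ ψ : ℝ → ℝ, IsTimeCutoff ψ →
          ∃ γ₀ : ℝ, 0 < γ₀ ∧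
            ∀ A : EuclideanSpace ℝ (Fin n) → ℝ → Matrix (Fin n) (Fin n) ℝ,
              AdmissibleCoefficients lam Lam M E A →
            ∀ R : ℝ, 0 < R → ∀ γ : ℝ, γ₀ ≤ γ →
            ∀ v : EuclideanSpace ℝ (Fin n) × ℝ → ℝ,
              ContDiff ℝ ∞ v → HasCompactSupport v → tsupport v ⊆ carlemanCylinder n R →
              c * lam ^ 2 * (∫ p in carlemanCylinder n R,
                  Real.exp (2 * carlemanWeight γ R ψ p) *
                    (γ ^ 3 * R ^ 2 * |v p| ^ 2 +
                      γ * ‖∇ (fun y => v (y, p.2)) p.1‖ ^ 2))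
                ≤ ∫ p in carlemanCylinder n R,
                  Real.exp (2 * carlemanWeight γ R ψ p) * |backwardParabolic A v p| ^ 2 := by
  refine ⟨1 / 5000, by norm_num, fun n lam Lam hlam hLam => ?_⟩
  have hC : 0 ≤ smallnessConst n Lam := by
    have : 0 < Lam := hlam.trans_le hLam
    rw [smallnessConst]; positivity
  -- The summand 1 keeps the denominator positive for n = 0, where `smallnessConst` vanishes.
  refine ⟨min 1 (lam ^ 2 / (smallnessConst n Lam + 1)), by positivity,
    fun M E hM hE hEE ψ hψ => ?_⟩
  have hE1 : E ≤ 1 := (hEE.trans_le (min_le_left _ _)).le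
  have hsmall : E * smallnessConst n Lam ≤ lam ^ 2 := by
    have h1 := (lt_div_iff₀ (by positivity)).1 (hEE.trans_le (min_le_right _ _))
    linarith
  have hψ2 : Continuous (deriv (deriv ψ)) :=
    (contDiff_infty_iff_deriv.1 (contDiff_infty_iff_deriv.1 hψ.smooth).2).2.continuous
  obtain ⟨K, hK⟩ := (isCompact_Icc (a := (0 : ℝ)) (b := 1)).exists_bound_of_continuousOn
    hψ2.continuousOn
  -- The cut-off enters the threshold for γ only through the bound `K` for |ψ''| on [0,1].
  refine ⟨max 1 (lowerOrderConst n lam Lam M K / lam ^ 2), by positivity,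
    fun A hA R hR γ hγ v hv hvc hvs => ?_⟩
  have hγ1 : 1 ≤ γ := (le_max_left _ _).trans hγ
  have hlarge : lowerOrderConst n lam Lam M K ≤ lam ^ 2 * γ := by
    have := (div_le_iff₀ (by positivity)).1 ((le_max_right _ _).trans hγ)
    linarith
  obtain ⟨a, ha, haA⟩ := hA.exists_extension hlam hLam
  have hsub := carlemanCylinder_subset_exteriorDomain n R
  have hbounds := hA.ae_derivative_bounds ha haA R
  have key := carleman_integral_inequality (M := M) (K := K) (γ := γ) ha
    (fun p hp i j => by rw [haA p (hsub hp), haA p (hsub hp)]; exact ((hA.symm p (hsub hp)).apply j i))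
    (fun p hp ξ => by
      have h := hA.elliptic p (hsub hp) (WithLp.toLp 2 ξ)
      rw [← sum_sq_eq_norm_sq] at h
      simp only [haA p (hsub hp)]
      exact h)
    (fun p hp i j => by rw [haA p (hsub hp)]; exact hA.abs_entry_le hlam hLam (hsub hp) i j)
    hbounds hlam hLam hM hE hE1 hsmall hψ.smooth (fun t ht => hK t ht) hγ1 hlarge hR hv hvc hvs
  have hmeas := (isOpen_carlemanCylinder n R).measurableSet
  have e1 : ∀ p : SpaceTime n, |v p| ^ 2 = v p ^ 2 ∧ ‖∇ (fun y => v (y, p.2)) p.1‖ ^ 2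
      = ∑ i, frameGrad (spaceDir n) v i p ^ 2 := fun p => by
    refine ⟨sq_abs _, ?_⟩
    rw [← sum_sq_eq_norm_sq]
    exact Finset.sum_congr rfl fun i _ => by
      rw [gradient_spaceSlice_apply (hv.differentiable (by simp) p)]; rfl
  have e2 : ∫ p in carlemanCylinder n R,
        Real.exp (2 * carlemanWeight γ R ψ p) * |backwardParabolic A v p| ^ 2
      = ∫ p in carlemanCylinder n R, Real.exp (2 * carlemanWeight γ R ψ p) *
        (dirDeriv (timeDir n) v p
          + frameDiv (spaceDir n) (flux a (frameGrad (spaceDir n) v)) p) ^ 2 := by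
    refine setIntegral_congr_ae hmeas ?_
    filter_upwards [hbounds] with p hp hpQ
    rw [sq_abs, backwardParabolic_eq haA hv hpQ fun i j => (hp hpQ i j).1]
  simp only [e1]
  rw [e2]
  exact key
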